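/- Let $(\mathcal A,\varphi)$ be a tracial non-commutative probability space (a unital $C^*$-algebra with a faithful tracial state), let $S=(S_t)_{t\ge 0}$ be a free Brownian motion in it, and let $I_2^S(f)$ denote the double Wigner integral of a kernel $f$ with respect to $S$. Let $L^2_s(\mathbb R_+^2)$ be the set of real $f\in L^2(\mathbb R_+^2)$ with $f(x,y)=f(y,x)$ a.e. For such $f$ let $T_f g=\int_0^\infty f(\cdot,y)g(y)\,dy$ be the associated Hilbert–Schmidt operator on $L^2(\mathbb R_+)$, let $E(f)$ be the set of its distinct non-zero eigenvalues, let $a(f)=\#E(f)$, and let $\mathrm{rank}(f)$ be the rank of $T_f$. Write $\widehat\kappa_r$ for the $r$-th free cumulant with respect to $\varphi$, and let $\xrightarrow{\ \mathrm{law}\ }$ mean convergence of all moments. Let $f\in L^2_s(\mathbb R_+^2)$ with $\mathrm{rank}(f)<\infty$, let $\mu_0\in\mathbb R$, and let $A\in\mathcal A$ be a self-adjoint element with the centered semicircular law $\mathcal S(0,\mu_0^2)$ of variance $\mu_0^2$, freely independent of $S$. Assume that $|\mu_0|+\|f\|_{L^2(\mathbb R_+^2)}>0$ and set $$Q(x)=x^{2(1+\mathbf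 1_{\{\mu_0\neq 0\}})}\prod_{\lambda\in E(f)}(x-\lambda)^2 .$$ Let $(F_n)$ be a sequence of double Wigner integrals, that is, $F_n=I_2^S(f_n)$ with $f_n\in L^2_s(\mathbb R_+^2)$. Then $\widehat\kappa_2(A+I_2^S(f))=\mu_0^2+\|f\|^2_{L^2(\mathbb R_+^2)}$ and, for every integer $r_0\ge 2(1+\mathbf 1_{\{\mu_0\neq0\}})$, one has, as $n\to\infty$, $$\text{(i)}\quad F_n\xrightarrow{\ \mathrm{law}\ }A+I_2^S(f)$$ if and only if the following three conditions all hold: (ii-a) $\widehat\kappa_2(F_n)\to\widehat\kappa_2(A+I_2^S(f))$; (ii-b) $\displaystyle\sum_{r=3}^{\deg Q}\frac{Q^{(r)}(0)}{r!}\,\widehat\kappa_r(F_n)\to\sum_{r=3}^{\deg Q}\frac{Q^{(r)}(0)}{r!}\,\widehat\kappa_r(I_2^S(f))$; (ii-c) $\widehat\kappa_r(F_n)\to\widehat\kappa_r(I_2^S(f))$ for the $a(f)$ consecutive values $r=r_0,r_0+1,\dots,r_0+a(f)-1$ (a void condition when $a(f)=0$). -/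

import Mathlib

open MeasureTheory Filter Topology
open scoped NNReal

namespace WignerChaos

noncomputable section

/-! ### Kernels on the quarter plane and their Hilbert-Schmidt operators -/

/-- Lebesgue measure on `ℝ₊ = [0, ∞)`. -/
abbrev halfLine : Measure ℝ := volume.restrict (Set.Ici 0)

/-- The real Hilbert space `L²(ℝ₊)`. -/
abbrev L2Line : Type := Lp ℝ 2 halfLine

/-- The real Hilbert space `L²(ℝ₊²)`. -/
abbrev L2Plane : Type := Lp ℝ 2 (halfLine.prod halfLine)

/-- `f(x, y) = f(y, x)` for almost every `(x, y)`; so `L²ₛ(ℝ₊²) = {f | IsSymm f}`. -/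
def IsSymm (f : L2Plane) : Prop :=
  ∀ᵐ p ∂(halfLine.prod halfLine), f p.swap = f p

theorem memLp_slice (f : L2Plane) :
    ∀ᵐ x ∂halfLine, MemLp (fun y => f (x, y)) 2 halfLine := by
  have hf := Lp.memLp f
  have h1 := ((memLp_two_iff_integrable_sq hf.1).1 hf).prod_right_ae
  have h2 := hf.1.prodMk_left
  filter_upwards [h1, h2] with x hx1 hx2
  exact (memLp_two_iff_integrable_sq hx2).2 hx1

theorem sq_integral_mul_le {u v : ℝ → ℝ} (hu : MemLp u 2 halfLine) (hv : MemLp v 2 halfLine) :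
    (∫ y, u y * v y ∂halfLine) ^ 2 ≤
      (∫ y, u y ^ 2 ∂halfLine) * (∫ y, v y ^ 2 ∂halfLine) := by
  have hu2 := (memLp_two_iff_integrable_sq hu.1).1 hu
  have hv2 := (memLp_two_iff_integrable_sq hv.1).1 hv
  have huv : Integrable (fun y => u y * v y) halfLine := hu.integrable_mul hv
  have key : ∀ s : ℝ, 0 ≤ (∫ y, u y ^ 2 ∂halfLine) * (s * s)
      + (2 * ∫ y, u y * v y ∂halfLine) * s + ∫ y, v y ^ 2 ∂halfLine := by
    intro s
    have h : 0 ≤ ∫ y, (s * u y + v y) ^ 2 ∂halfLine := integral_nonneg fun y => sq_nonneg _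
    have e : ∫ y, (s * u y + v y) ^ 2 ∂halfLine
        = ∫ y, ((s * s) * u y ^ 2 + (2 * s) * (u y * v y)) + v y ^ 2 ∂halfLine := by
      congr 1; ext y; ring
    have e2 : Integrable (fun y => (s * s) * u y ^ 2 + (2 * s) * (u y * v y)) halfLine :=
      (hu2.const_mul _).add (huv.const_mul _)
    rw [e, integral_add e2 hv2, integral_add (hu2.const_mul _) (huv.const_mul _),
      integral_const_mul, integral_const_mul] at h
    linarith
  have := discrim_le_zero key
  unfold discrim at this
  nlinarith

theorem memLp_kernel_integral (f : L2Plane) (g : L2Line) :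
    MemLp (fun x => ∫ y, f (x, y) * g y ∂halfLine) 2 halfLine := by
  have hf := Lp.memLp f
  have hg := Lp.memLp g
  have hmeas : AEStronglyMeasurable (fun x => ∫ y, f (x, y) * g y ∂halfLine) halfLine :=
    (hf.1.mul hg.1.comp_snd).integral_prod_right'
  refine (memLp_two_iff_integrable_sq hmeas).2 ?_
  have hI := (((memLp_two_iff_integrable_sq hf.1).1 hf).integral_prod_left).mul_const
    (∫ y, g y ^ 2 ∂halfLine)
  refine hI.mono' (hmeas.pow 2) ?_
  filter_upwards [memLp_slice f] with x hx
  rw [Real.norm_of_nonneg (sq_nonneg _)]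
  exact sq_integral_mul_le hx hg

/-- The Hilbert-Schmidt operator `T_f g = ∫₀^∞ f(·, y) g(y) dy` on `L²(ℝ₊)`. -/
def kernelOperator (f : L2Plane) : L2Line →ₗ[ℝ] L2Line where
  toFun g := (memLp_kernel_integral f g).toLp _
  map_add' g h := by
    rw [← MemLp.toLp_add]
    refine MemLp.toLp_congr _ _ ?_
    filter_upwards [memLp_slice f] with x hx
    have e : (fun y => f (x, y) * (g + h : L2Line) y) =ᵐ[halfLine]
        fun y => f (x, y) * g y + f (x, y) * h y := by
      filter_upwards [Lp.coeFn_add g h] with y hy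
      rw [hy, Pi.add_apply, mul_add]
    rw [integral_congr_ae e]
    exact integral_add (hx.integrable_mul (Lp.memLp g)) (hx.integrable_mul (Lp.memLp h))
  map_smul' c g := by
    rw [RingHom.id_apply, ← MemLp.toLp_const_smul]
    refine MemLp.toLp_congr _ _ (Eventually.of_forall fun x => ?_)
    have e : (fun y => f (x, y) * (c • g : L2Line) y) =ᵐ[halfLine]
        fun y => c * (f (x, y) * g y) := by
      filter_upwards [Lp.coeFn_smul c g] with y hy
      rw [hy, Pi.smul_apply, smul_eq_mul]; ring
    change ∫ y, f (x, y) * (c • g : L2Line) y ∂halfLine = c • ∫ y, f (x, y) * g y ∂halfLine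
    rw [integral_congr_ae e, integral_const_mul, smul_eq_mul]

/-- `rank(f) < ∞`: the operator `T_f` has finite-dimensional range. -/
def HasFiniteRank (f : L2Plane) : Prop :=
  FiniteDimensional ℝ (LinearMap.range (kernelOperator f))

/-- `E(f)`, the set of distinct non-zero eigenvalues of `T_f`. -/
def nonzeroEigenvalues (f : L2Plane) : Set ℝ :=
  {l | l ≠ 0 ∧ Module.End.HasEigenvalue (kernelOperator f) l}

/-- `a(f)`, the number of distinct non-zero eigenvalues of `T_f`. -/
def numEigenvalues (f : L2Plane) : ℕ := (nonzeroEigenvalues f).ncard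

/-- `2 (1 + 1_{μ₀ ≠ 0})`. -/
def baseOrder (μ₀ : ℝ) : ℕ := 2 * (1 + if μ₀ ≠ 0 then 1 else 0)

open Polynomial in
/-- `Q(x) = x ^ (2 (1 + 1_{μ₀ ≠ 0})) ∏ (x - l)²`, the product over the distinct non-zero
eigenvalues `l` of `T_f` (a finite set when `f` has finite rank). -/
def polyQ (μ₀ : ℝ) (f : L2Plane) : ℝ[X] :=
  X ^ baseOrder μ₀ * ∏ᶠ l ∈ nonzeroEigenvalues f, (X - C l) ^ 2

/-- The Taylor coefficient `Q⁽ʳ⁾(0) / r!`. -/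
def taylorCoeff (Q : Polynomial ℝ) (r : ℕ) : ℝ :=
  (Polynomial.derivative^[r] Q).eval 0 / (r.factorial : ℝ)

/-! ### Non-commutative probability -/

variable {A : Type*} [CStarAlgebra A]

/-- `φ` is a faithful tracial state on the C⋆-algebra `A`. -/
structure IsFaithfulTracialState (φ : A →ₗ[ℂ] ℂ) : Prop where
  map_one : φ 1 = 1
  nonneg : ∀ x : A, 0 ≤ (φ (star x * x)).re ∧ (φ (star x * x)).im = 0
  trace : ∀ x y : A, φ (x * y) = φ (y * x)
  faithful : ∀ x : A, φ (star x * x) = 0 → x = 0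

/-- Free independence of a family of unital ⋆-subalgebras: alternating products of centered
elements are centered. -/
def FreelyIndependent (φ : A →ₗ[ℂ] ℂ) {ι : Type*} (B : ι → StarSubalgebra ℂ A) : Prop :=
  ∀ (n : ℕ) (i : Fin (n + 1) → ι) (x : Fin (n + 1) → A),
    (∀ k, x k ∈ B (i k)) → (∀ k, φ (x k) = 0) →
    (∀ k : Fin n, i k.castSucc ≠ i k.succ) → φ (List.ofFn x).prod = 0

/-- The self-adjoint element `x` has law `μ` (for `μ` compactly supported): the `k`-th moment of
`x` is `∫ tᵏ dμ(t)`, for every `k`. -/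
def HasLaw (φ : A →ₗ[ℂ] ℂ) (x : A) (μ : Measure ℝ) : Prop :=
  IsSelfAdjoint x ∧ ∀ k : ℕ, φ (x ^ k) = ((∫ t, t ^ k ∂μ : ℝ) : ℂ)

/-- The centered semicircular law of variance `v`: the dilation by `√v` of the law with density
`√(4 - t²) / (2π)` on `[-2, 2]` (the square root vanishes off that interval). It is the Dirac
mass at `0` when `v = 0`. -/
def semicircularLaw (v : ℝ) : Measure ℝ :=
  (volume.withDensity fun t : ℝ => ENNReal.ofReal (√(4 - t ^ 2) / (2 * Real.pi))).map
    fun t => √v * t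

/-- A free Brownian motion: a self-adjoint process started at `0`, with freely independent
increments, such that `S_t - S_s` is centered semicircular of variance `t - s`. -/
structure IsFreeBrownianMotion (φ : A →ₗ[ℂ] ℂ) (S : ℝ≥0 → A) : Prop where
  zero : S 0 = 0
  selfAdjoint : ∀ t, IsSelfAdjoint (S t)
  increment_law : ∀ s t : ℝ≥0, s ≤ t → HasLaw φ (S t - S s) (semicircularLaw ((t : ℝ) - s))
  increment_free : ∀ t : ℕ → ℝ≥0, Monotone t →
    FreelyIndependent φ fun i : ℕ => StarAlgebra.adjoin ℂ {S (t (i + 1)) - S (t i)}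

/-- `x` is freely independent of the process `S`. -/
def FreelyIndependentOf (φ : A →ₗ[ℂ] ℂ) (x : A) (S : ℝ≥0 → A) : Prop :=
  FreelyIndependent φ ![StarAlgebra.adjoin ℂ {x}, StarAlgebra.adjoin ℂ (Set.range S)]

/-- `F_n` converges in law to `G`: all moments converge. -/
def ConvergesInLaw (φ : A →ₗ[ℂ] ℂ) (F : ℕ → A) (G : A) : Prop :=
  ∀ k : ℕ, Tendsto (fun n => φ (F n ^ k)) atTop (𝓝 (φ (G ^ k)))

/-! ### Free cumulants -/

/-- The moment series `M(z) = ∑ φ(xⁿ) zⁿ`. -/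
def momentSeries (φ : A →ₗ[ℂ] ℂ) (x : A) : PowerSeries ℂ := PowerSeries.mk fun n => φ (x ^ n)

/-- The free cumulants of `x`, by the moment-cumulant recursion: with the convention that the
`0`-th one is `φ(1) = 1`, they are determined by
`φ(xⁿ) = ∑_{s ≤ n} κ_s ∑_{i₁ + ⋯ + i_s = n - s} φ(x^{i₁}) ⋯ φ(x^{i_s})`,
that is by `C(z M(z)) = M(z)` for `C(z) = ∑ κ_s zˢ`. The inner sum is the coefficient of
`z^{n-s}` in `M(z)ˢ`; it is `1` for `s = n`. -/
def freeCumulant (φ : A →ₗ[ℂ] ℂ) (x : A) (n : ℕ) : ℂ :=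
  φ (x ^ n) - ∑ s : Fin n,
    freeCumulant φ x s * PowerSeries.coeff (n - (s : ℕ)) (momentSeries φ x ^ (s : ℕ))
termination_by n
decreasing_by exact s.2

theorem moment_eq_sum_freeCumulant (φ : A →ₗ[ℂ] ℂ) (h1 : φ 1 = 1) (x : A) (n : ℕ) :
    φ (x ^ n) = ∑ s ∈ Finset.range (n + 1),
      freeCumulant φ x s * PowerSeries.coeff (n - s) (momentSeries φ x ^ s) := by
  have hc : PowerSeries.coeff 0 (momentSeries φ x ^ n) = 1 := by
    simp [momentSeries, h1]
  rw [Finset.sum_range_succ, Nat.sub_self, hc, mul_one, freeCumulant, Finset.sum_range]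
  ring

/-! ### Double Wigner integrals -/

/-- An off-diagonal step kernel `∑_{i,j<N} c_{ij} 1_{(t_i, t_{i+1}]}(x) 1_{(t_j, t_{j+1}]}(y)`,
with `c_{ii} = 0`. -/
structure StepKernel where
  size : ℕ
  time : ℕ → ℝ≥0
  mono : Monotone time
  coeff : ℕ → ℕ → ℝ
  diag : ∀ i, coeff i i = 0

/-- The function on `ℝ₊²` given by a step kernel. -/
def StepKernel.toFun (g : StepKernel) (p : ℝ × ℝ) : ℝ :=
  ∑ i ∈ Finset.range g.size, ∑ j ∈ Finset.range g.size, g.coeff i j *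
    ((Set.Ioc (g.time i : ℝ) (g.time (i + 1))).indicator 1 p.1 *
      (Set.Ioc (g.time j : ℝ) (g.time (j + 1))).indicator 1 p.2)

/-- The double Wigner integral of a step kernel,
`∑_{i,j<N} c_{ij} (S_{t_{i+1}} - S_{t_i}) (S_{t_{j+1}} - S_{t_j})`. -/
def StepKernel.integral (S : ℝ≥0 → A) (g : StepKernel) : A :=
  ∑ i ∈ Finset.range g.size, ∑ j ∈ Finset.range g.size, (g.coeff i j : ℂ) •
    ((S (g.time (i + 1)) - S (g.time i)) * (S (g.time (j + 1)) - S (g.time j)))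

/-- `F = I₂ˢ(f)`: the double Wigner integral is the extension by continuity, from `L²(ℝ₊²)` to
`L²(φ)`, of the integral of off-diagonal step kernels. -/
def IsDoubleWignerIntegral (φ : A →ₗ[ℂ] ℂ) (S : ℝ≥0 → A) (f : L2Plane) (F : A) : Prop :=
  ∃ g : ℕ → StepKernel,
    Tendsto (fun k => eLpNorm (fun p => f p - (g k).toFun p) 2 (halfLine.prod halfLine))
      atTop (𝓝 0) ∧
    Tendsto (fun k => φ (star (F - (g k).integral S) * (F - (g k).integral S))) atTop (𝓝 0)

/-- `F` belongs to the second (symmetric) Wigner chaos: `F = I₂ˢ(f)` with `f ∈ L²ₛ(ℝ₊²)`. -/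
def InSecondWignerChaos (φ : A →ₗ[ℂ] ℂ) (S : ℝ≥0 → A) (F : A) : Prop :=
  ∃ f : L2Plane, IsSymm f ∧ IsDoubleWignerIntegral φ S f F

end

end WignerChaos

open WignerChaos

/-!
The argument has three parts.

*Cumulants are power sums of eigenvalues.* For free semicircular elements `x_p` of variances `v_p`,
free from a semicircular `a` of variance `v₀`, the free cumulants of `Y = a + ∑ C_{pq} x_p x_q` are
`κ_r = v₀ 1_{r = 2} + tr ((C D)ʳ)` with `D = diag(v)` (`freeCumulant_quadraticElement`). This comes
from the Schwinger-Dyson equations `φ(x_p W) = v_p (φ ⊗ φ)(∂_p W)`: they hold for one semicircular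
element by the Catalan recursion, pass to free products (`FreelyIndependent.schwingerDyson`), and
give a closed equation for the matrix series `∑ₖ φ(x_p Yᵏ x_q) zᵏ`, whose solution is a resolvent.
Step kernels are such quadratic forms. A double Wigner integral `F = I₂(f)` is an `L²(φ)`-limit of
integrals of symmetric step kernels with bounded moments, so that all moments of `a + F` converge
along the approximation, and `κ_r(a + F) = v₀ 1_{r = 2} + lim_k ∑ᵢ l_{k,i}ʳ` for finite real spectra
`l_k` (`IsDoubleWignerIntegral.exists_spectra`).

*Concentration.* Put `P = Xᵉ ∏_{l ∈ E(f)} (X - l)` with `e = 1_{μ₀ ≠ 0}`, so that `Q = X² P²`; let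
`ℓ_n` and `ℓ` be the functionals `Xᵏ ↦ κ_{k+2}` on polynomials, for `F_n` and for `a + I₂(f)`. Then
`ℓ_n(R)` is a limit of sums `∑ᵢ lᵢ² R(lᵢ)` and is therefore positive, and convergence of the second
cumulants and of the Taylor sums of `Q` means that `ℓ_n(1) → ℓ(1)` and `ℓ_n(P²) → ℓ(P²)`. Since
`T_f ∏ (T_f - l) = 0`, and since the semicircular part only sees the value at `0`, the functional
`ℓ` vanishes on the ideal `(P)` (`IsDoubleWignerIntegral.exists_limit_cumulants`). So
`ℓ_n(P²) → 0`, and by the Cauchy-Schwarz inequality `ℓ_n → 0` on `(P)` (`tendsto_polyMean_mul`).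

*Linear algebra modulo `P`.* As `X` is invertible modulo `∏ (X - l)`, any `a(f)` consecutive powers
of `X`, together with `1` when `μ₀ ≠ 0`, span the polynomials modulo `P`. Hence `ℓ_n → ℓ` everywhere
(`tendsto_of_tendsto_consecutive`), that is, all free cumulants converge, and with them all moments.
-/

namespace WignerChaos

/-! ### Moments of the semicircular law -/

section Semicircle

open Finset.HasAntidiagonal

/-- The `k`-th moment of the density `√(4 - t²)` on `[-2, 2]`, not normalized. -/
noncomputable def semicircleIntegral (k : ℕ) : ℝ := ∫ t in (-2 : ℝ)..2, t ^ k * √(4 - t ^ 2)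

theorem semicircleIntegral_zero : semicircleIntegral 0 = 2 * Real.pi := by
  have h := intervalIntegral.integral_comp_div (a := -2) (b := 2) (fun x : ℝ => √(1 - x ^ 2))
    (two_ne_zero : (2 : ℝ) ≠ 0)
  have e : ∀ t : ℝ, √(4 - t ^ 2) = 2 * √(1 - (t / 2) ^ 2) := fun t => by
    rw [show 4 - t ^ 2 = 2 ^ 2 * (1 - (t / 2) ^ 2) by ring, Real.sqrt_mul (by norm_num),
      Real.sqrt_sq (by norm_num)]
  simp only [semicircleIntegral, pow_zero, one_mul, e]
  rw [intervalIntegral.integral_const_mul, h]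
  norm_num [integral_sqrt_one_sub_sq]
  ring

theorem semicircleIntegral_one : semicircleIntegral 1 = 0 := by
  have h := intervalIntegral.integral_comp_neg (a := -2) (b := 2)
    (fun t : ℝ => t ^ 1 * √(4 - t ^ 2))
  simp only [neg_sq, pow_one, neg_mul, intervalIntegral.integral_neg, neg_neg] at h
  simp only [semicircleIntegral, pow_one]
  linarith

/-- Obtained by integrating the derivative of `t ^ (k + 1) (4 - t²) ^ (3 / 2)`, which vanishes at
both ends. -/
theorem semicircleIntegral_add_two (k : ℕ) :
    (k + 4) * semicircleIntegral (k + 2) = 4 * (k + 1) * semicircleIntegral k := by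
  have hcont : ∀ m : ℕ, Continuous fun t : ℝ => t ^ m * √(4 - t ^ 2) := fun m => by fun_prop
  have hd : ∀ t ∈ Set.Ioo (-2 : ℝ) 2,
      HasDerivAt (fun t : ℝ => t ^ (k + 1) * ((4 - t ^ 2) * √(4 - t ^ 2)))
        (4 * (k + 1) * (t ^ k * √(4 - t ^ 2)) - (k + 4) * (t ^ (k + 2) * √(4 - t ^ 2))) t := by
    intro t ht
    have hpos : 0 < 4 - t ^ 2 := by nlinarith [ht.1, ht.2]
    have h1 : HasDerivAt (fun t : ℝ => 4 - t ^ 2) (-(2 * t)) t := by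
      simpa using (hasDerivAt_pow 2 t).const_sub 4
    have h2 := h1.sqrt hpos.ne'
    have h3 := (hasDerivAt_pow (k + 1) t).mul (h1.mul h2)
    refine HasDerivAt.congr_deriv h3 ?_
    have hs : √(4 - t ^ 2) ≠ 0 := (Real.sqrt_pos.2 hpos).ne'
    have hq : √(4 - t ^ 2) ^ 2 = 4 - t ^ 2 := Real.sq_sqrt hpos.le
    push_cast
    have e : (4 - t ^ 2) * (-(2 * t) / (2 * √(4 - t ^ 2))) = -t * √(4 - t ^ 2) := by
      field_simp
      rw [hq]
    rw [e, Pi.mul_apply]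
    ring
  have hint := intervalIntegral.integral_eq_sub_of_hasDerivAt_of_le (by norm_num : (-2 : ℝ) ≤ 2)
    (by fun_prop) hd ((((hcont k).const_mul _).sub ((hcont (k + 2)).const_mul _)).intervalIntegrable
      _ _)
  rw [intervalIntegral.integral_sub (((hcont k).const_mul _).intervalIntegrable _ _)
    (((hcont (k + 2)).const_mul _).intervalIntegrable _ _), intervalIntegral.integral_const_mul,
    intervalIntegral.integral_const_mul] at hint
  norm_num at hint
  simp only [semicircleIntegral]
  linarith

theorem semicircleIntegral_odd (k : ℕ) : semicircleIntegral (2 * k + 1) = 0 := by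
  induction k with
  | zero => exact semicircleIntegral_one
  | succ k ih =>
    have h := semicircleIntegral_add_two (2 * k + 1)
    rw [ih, mul_zero] at h
    refine (mul_eq_zero.1 h).resolve_left ?_
    positivity

theorem semicircleIntegral_even (k : ℕ) :
    semicircleIntegral (2 * k) = 2 * Real.pi * catalan k := by
  induction k with
  | zero => simpa using semicircleIntegral_zero
  | succ k ih =>
    have h := semicircleIntegral_add_two (2 * k)
    have h1 : ((k : ℝ) + 1) * catalan k = k.centralBinom := by
      exact_mod_cast succ_mul_catalan_eq_centralBinom k
    have h2 : ((k : ℝ) + 2) * catalan (k + 1) = (k + 1).centralBinom := by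
      exact_mod_cast succ_mul_catalan_eq_centralBinom (k + 1)
    have h3 : ((k : ℝ) + 1) * (k + 1).centralBinom = 2 * (2 * k + 1) * k.centralBinom := by
      exact_mod_cast Nat.succ_mul_centralBinom_succ k
    have h4 : ((k : ℝ) + 2) * catalan (k + 1) = 2 * (2 * k + 1) * catalan k := by
      have hk : (k : ℝ) + 1 ≠ 0 := by positivity
      apply mul_left_cancel₀ hk
      rw [h2, h3, ← h1]
      ring
    rw [ih] at h
    have hk : (k : ℝ) + 2 ≠ 0 := by positivity
    rw [show 2 * (k + 1) = 2 * k + 2 by ring]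
    apply mul_left_cancel₀ hk
    push_cast at h
    linear_combination h / 2 - 2 * Real.pi * h4

theorem integral_pow_semicircularLaw (v : ℝ) (k : ℕ) :
    ∫ t, t ^ k ∂(semicircularLaw v) = √v ^ k * (semicircleIntegral k / (2 * Real.pi)) := by
  rw [semicircularLaw, integral_map (by fun_prop) (by fun_prop),
    integral_withDensity_eq_integral_toReal_smul (by fun_prop)
      (Eventually.of_forall fun _ => ENNReal.ofReal_lt_top)]
  have e : ∀ t : ℝ, (ENNReal.ofReal (√(4 - t ^ 2) / (2 * Real.pi))).toReal • (√v * t) ^ k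
      = √v ^ k / (2 * Real.pi) * (t ^ k * √(4 - t ^ 2)) := fun t => by
    rw [ENNReal.toReal_ofReal (by positivity), smul_eq_mul]
    ring
  simp_rw [e]
  rw [integral_const_mul, semicircleIntegral, intervalIntegral.integral_of_le (by norm_num),
    setIntegral_eq_integral_of_forall_compl_eq_zero]
  · ring
  · intro t ht
    have : 4 - t ^ 2 ≤ 0 := by
      rw [Set.mem_Ioc, not_and_or, not_lt, not_le] at ht
      rcases ht with h | h <;> nlinarith
    rw [Real.sqrt_eq_zero_of_nonpos this, mul_zero]

variable {A : Type*} [CStarAlgebra A] {φ : A →ₗ[ℂ] ℂ} {x : A} {v : ℝ}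

theorem HasLaw.moment_even (hx : HasLaw φ x (semicircularLaw v)) (hv : 0 ≤ v) (k : ℕ) :
    φ (x ^ (2 * k)) = (v : ℂ) ^ k * catalan k := by
  rw [hx.2, integral_pow_semicircularLaw, semicircleIntegral_even, pow_mul, Real.sq_sqrt hv,
    mul_div_cancel_left₀ _ (by positivity)]
  push_cast
  rfl

theorem HasLaw.moment_odd (hx : HasLaw φ x (semicircularLaw v)) (k : ℕ) :
    φ (x ^ (2 * k + 1)) = 0 := by
  rw [hx.2, integral_pow_semicircularLaw, semicircleIntegral_odd]
  simp

theorem HasLaw.map_eq_zero (hx : HasLaw φ x (semicircularLaw v)) : φ x = 0 := by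
  simpa using hx.moment_odd 0

/-- The Catalan recursion for the moments of a semicircular element. -/
theorem HasLaw.moment_add_two (hx : HasLaw φ x (semicircularLaw v)) (hv : 0 ≤ v) (k : ℕ) :
    φ (x ^ (k + 2)) = v * ∑ p ∈ antidiagonal k, φ (x ^ p.1) * φ (x ^ p.2) := by
  obtain ⟨m, rfl | rfl⟩ := Nat.even_or_odd' k
  · rw [show 2 * m + 2 = 2 * (m + 1) by ring, hx.moment_even hv, catalan_succ']
    have hsub : (antidiagonal m).image (fun p => (2 * p.1, 2 * p.2)) ⊆
        antidiagonal (2 * m) := by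
      intro p hp
      simp only [Finset.mem_image, mem_antidiagonal] at hp ⊢
      obtain ⟨q, hq, rfl⟩ := hp
      simp only
      omega
    rw [← Finset.sum_subset hsub, Finset.sum_image]
    · rw [pow_succ']
      push_cast
      rw [mul_assoc, Finset.mul_sum]
      congr 1
      refine Finset.sum_congr rfl fun p hp => ?_
      rw [hx.moment_even hv, hx.moment_even hv, ← mem_antidiagonal.1 hp, pow_add]
      ring
    · intro p _ q _ h
      simp only [Prod.mk.injEq] at h
      ext <;> omega
    · intro p hp hp'
      obtain ⟨j, hj | hj⟩ := Nat.even_or_odd' p.1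
      · refine absurd (Finset.mem_image.2 ⟨(j, m - j), ?_, ?_⟩) hp' <;>
          simp only [mem_antidiagonal] at hp ⊢
        · omega
        · ext <;> simp only <;> omega
      · rw [hj, hx.moment_odd, zero_mul]
  · rw [show 2 * m + 1 + 2 = 2 * (m + 1) + 1 by ring, hx.moment_odd, Finset.sum_eq_zero, mul_zero]
    intro p hp
    rw [mem_antidiagonal] at hp
    obtain ⟨j, hj | hj⟩ := Nat.even_or_odd' p.1
    · obtain ⟨i, hi⟩ : ∃ i, p.2 = 2 * i + 1 := ⟨m - j, by omega⟩
      rw [hi, hx.moment_odd, mul_zero]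
    · rw [hj, hx.moment_odd, zero_mul]

end Semicircle

/-! ### Schwinger-Dyson equations in free products -/

section SchwingerDyson

variable {A : Type*} [CStarAlgebra A] (φ : A →ₗ[ℂ] ℂ)

/-- The operator `(q, η) ↦ (b q, c φ(q) φ + η(· b))`. Starting from `(1, 0)`, a word in such
operators computes the word `q` in the elements `b` together with the functional
`η = (φ ⊗ φ)((· ⊗ 1) ∂q)`, where `∂` is the free difference quotient with `∂b = c (1 ⊗ 1)`. -/
noncomputable def diffLetter (b : A) (c : ℂ) : Module.End ℂ (A × Module.Dual ℂ A) :=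
  ((LinearMap.mulLeft ℂ b) ∘ₗ LinearMap.fst ℂ A (Module.Dual ℂ A)).prod
    ((c • φ.smulRight φ) ∘ₗ LinearMap.fst ℂ A (Module.Dual ℂ A) +
      (LinearMap.lcomp ℂ ℂ (LinearMap.mulRight ℂ b)) ∘ₗ LinearMap.snd ℂ A (Module.Dual ℂ A))

@[simp] theorem diffLetter_fst (b : A) (c : ℂ) (u : A × Module.Dual ℂ A) :
    (diffLetter φ b c u).1 = b * u.1 := by simp [diffLetter]

@[simp] theorem diffLetter_snd (b : A) (c : ℂ) (u : A × Module.Dual ℂ A) (x : A) :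
    (diffLetter φ b c u).2 x = c * (φ u.1 * φ x) + u.2 (x * b) := by
  simp [diffLetter]

/-- The operators `(q, η) ↦ (P q, (φ ⊗ φ)((· ⊗ 1) T (1 ⊗ q)) + η(· P))` with `P ∈ B` and, as far
as `φ` can see, `T ∈ B ⊗ B`. -/
def localOps (B : Subalgebra ℂ A) : Subalgebra ℂ (Module.End ℂ (A × Module.Dual ℂ A)) where
  carrier := {T | ∃ P ∈ B, (∀ u, (T u).1 = P * u.1) ∧
    (∀ u x, (T u).2 x = (T (u.1, 0)).2 x + u.2 (x * P)) ∧
    (∀ q, (∀ b ∈ B, φ (b * q) = 0) → (T (q, 0)).2 = 0) ∧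
    ∀ x, (∀ b ∈ B, φ (x * b) = 0) → ∀ q, (T (q, 0)).2 x = 0}
  mul_mem' := by
    rintro T T' ⟨P, hP, h1, h2, h3, h4⟩ ⟨P', hP', h1', h2', h3', h4'⟩
    refine ⟨P * P', mul_mem hP hP', fun u => ?_, fun u x => ?_, fun q hq => ?_, fun x hx q => ?_⟩
    · simp [Module.End.mul_apply, h1, h1', mul_assoc]
    · rw [Module.End.mul_apply, Module.End.mul_apply, h2 (T' u), h2 (T' (u.1, 0)), h2' u, h1',
        h1', mul_assoc, add_assoc]
    · ext x
      rw [Module.End.mul_apply, h2, h1', h3, h3' q hq]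
      · simp
      · intro b hb
        rw [← mul_assoc]
        exact hq _ (mul_mem hb hP')
    · rw [Module.End.mul_apply, h2, h4 x hx, h4', add_zero]
      intro b hb
      rw [mul_assoc]
      exact hx _ (mul_mem hP hb)
  add_mem' := by
    rintro T T' ⟨P, hP, h1, h2, h3, h4⟩ ⟨P', hP', h1', h2', h3', h4'⟩
    refine ⟨P + P', add_mem hP hP', fun u => ?_, fun u x => ?_, fun q hq => ?_, fun x hx q => ?_⟩
    · simp [h1, h1', add_mul]
    · simp only [LinearMap.add_apply, Prod.snd_add]
      rw [h2, h2', mul_add, map_add]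
      ring
    · simp [h3 q hq, h3' q hq]
    · simp [h4 x hx, h4' x hx]
  algebraMap_mem' c := by
    refine ⟨algebraMap ℂ A c, B.algebraMap_mem c, fun u => ?_, fun u x => ?_, fun q hq => ?_,
      fun x hx q => ?_⟩ <;> simp [Algebra.algebraMap_eq_smul_one]

theorem diffLetter_mem_localOps {B : Subalgebra ℂ A} {b : A} (hb : b ∈ B) (c : ℂ) :
    diffLetter φ b c ∈ localOps φ B := by
  refine ⟨b, hb, fun u => diffLetter_fst φ b c u, fun u x => by simp, fun q hq => ?_,
    fun x hx q => ?_⟩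
  · ext x
    have := hq 1 (one_mem B)
    rw [one_mul] at this
    simp [this]
  · have := hx 1 (one_mem B)
    rw [mul_one] at this
    simp [this]

variable {φ}

/-- Free independence with the alternating products indexed by lists. -/
theorem FreelyIndependent.list_prod {ι : Type*} {B : ι → StarSubalgebra ℂ A}
    (h : FreelyIndependent φ B) (L : List (ι × A)) (hL : L ≠ []) (hmem : ∀ p ∈ L, p.2 ∈ B p.1)
    (h0 : ∀ p ∈ L, φ p.2 = 0) (hch : (L.map Prod.fst).IsChain (· ≠ ·)) :
    φ (L.map Prod.snd).prod = 0 := by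
  obtain ⟨n, hn⟩ : ∃ n, L.length = n + 1 :=
    ⟨L.length - 1, by have := List.length_pos_iff.2 hL; omega⟩
  have key := h n (fun k => (L[(k : ℕ)]'(by omega)).1) (fun k => (L[(k : ℕ)]'(by omega)).2)
    (fun k => hmem _ (List.getElem_mem _)) (fun k => h0 _ (List.getElem_mem _)) (fun k => by
      have := List.isChain_iff_getElem.1 hch k (by simp; omega)
      simpa using this)
  convert key using 3
  apply List.ext_getElem
  · simp [hn]
  · intro i h1 h2
    simp only [List.getElem_map, List.getElem_ofFn]

variable {ι : Type*} {B : ι → StarSubalgebra ℂ A}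

theorem FreelyIndependent.mul_list_prod (h1 : φ 1 = 1) (h : FreelyIndependent φ B) {i : ι} {b : A}
    (hb : b ∈ B i) (L : List (ι × A)) (hL : L ≠ []) (hmem : ∀ p ∈ L, p.2 ∈ B p.1)
    (h0 : ∀ p ∈ L, φ p.2 = 0) (hch : (i :: L.map Prod.fst).IsChain (· ≠ ·)) :
    φ (b * (L.map Prod.snd).prod) = 0 := by
  have e1 := h.list_prod L hL hmem h0 hch.tail
  have e2 := h.list_prod ((i, b - φ b • 1) :: L) (by simp)
    (by
      intro p hp
      rcases List.mem_cons.1 hp with rfl | hp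
      · exact sub_mem hb ((B i).smul_mem (one_mem _) _)
      · exact hmem p hp)
    (by
      intro p hp
      rcases List.mem_cons.1 hp with rfl | hp
      · simp [h1]
      · exact h0 p hp) (by simpa using hch)
  simpa [sub_mul, e1] using e2

theorem FreelyIndependent.list_prod_mul (h1 : φ 1 = 1) (h : FreelyIndependent φ B) {i : ι} {b : A}
    (hb : b ∈ B i) (L : List (ι × A)) (hL : L ≠ []) (hmem : ∀ p ∈ L, p.2 ∈ B p.1)
    (h0 : ∀ p ∈ L, φ p.2 = 0) (hch : (L.map Prod.fst ++ [i]).IsChain (· ≠ ·)) :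
    φ ((L.map Prod.snd).prod * b) = 0 := by
  have e1 := h.list_prod L hL hmem h0 hch.left_of_append
  have e2 := h.list_prod (L ++ [(i, b - φ b • 1)]) (by simp)
    (by
      intro p hp
      rcases List.mem_append.1 hp with hp | hp
      · exact hmem p hp
      · rw [List.mem_singleton.1 hp]
        exact sub_mem hb ((B i).smul_mem (one_mem _) _))
    (by
      intro p hp
      rcases List.mem_append.1 hp with hp | hp
      · exact h0 p hp
      · rw [List.mem_singleton.1 hp]
        simp [h1]) (by simpa using hch)
  simpa [mul_sub, e1] using e2

theorem fst_list_prod {B : ι → Subalgebra ℂ A}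
    (L : List (ι × Module.End ℂ (A × Module.Dual ℂ A)))
    (hmem : ∀ p ∈ L, p.2 ∈ localOps φ (B p.1)) :
    ((L.map Prod.snd).prod (1, 0)).1 = (L.map fun p => (p.2 (1, 0)).1).prod := by
  induction L with
  | nil => simp
  | cons p L ih =>
    obtain ⟨P, -, h, -⟩ := hmem p (by simp)
    simp only [List.map_cons, List.prod_cons, Module.End.mul_apply]
    rw [h, h, ih fun p hp => hmem p (by simp [hp]), mul_one]

theorem fst_mem_of_mem_localOps {B : Subalgebra ℂ A} {T : Module.End ℂ (A × Module.Dual ℂ A)}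
    (hT : T ∈ localOps φ B) : (T (1, 0)).1 ∈ B := by
  obtain ⟨P, hP, h, -⟩ := hT
  simpa [h] using hP

/-- The free difference quotient of an alternating product of at least two centered elements,
split into `R` and `L`, is invisible to `φ ⊗ φ`: each of its terms keeps a nonempty alternating
centered factor. -/
theorem FreelyIndependent.snd_list_prod (h1 : φ 1 = 1) (h : FreelyIndependent φ B)
    (L : List (ι × Module.End ℂ (A × Module.Dual ℂ A))) (R : List (ι × A))
    (hlen : 2 ≤ R.length + L.length)
    (hL : ∀ p ∈ L, p.2 ∈ localOps φ (B p.1).toSubalgebra ∧ φ (p.2 (1, 0)).1 = 0)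
    (hR : ∀ p ∈ R, p.2 ∈ B p.1 ∧ φ p.2 = 0)
    (hch : (R.map Prod.fst ++ L.map Prod.fst).IsChain (· ≠ ·)) :
    ((L.map Prod.snd).prod (1, 0)).2 (R.map Prod.snd).prod = 0 := by
  induction L generalizing R with
  | nil => simp
  | cons p L ih =>
    obtain ⟨i, T⟩ := p
    obtain ⟨⟨P, hP, hT1, hT2, hT3, hT4⟩, hT0⟩ := hL (i, T) (by simp)
    simp only [List.map_cons, List.prod_cons, Module.End.mul_apply]
    rw [hT2]
    have hPP : (T (1, 0)).1 = P := by simp [hT1]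
    have second : ((L.map Prod.snd).prod (1, 0)).2 ((R.map Prod.snd).prod * P) = 0 := by
      by_cases hLn : L = []
      · simp [hLn]
      · have := ih (R ++ [(i, P)]) (by
          have := List.length_pos_iff.2 hLn
          simp only [List.length_cons, List.length_append, List.length_nil] at hlen ⊢
          omega)
          (fun p hp => hL p (by simp [hp]))
          (by
            intro p hp
            rcases List.mem_append.1 hp with hp | hp
            · exact hR p hp
            · rw [List.mem_singleton.1 hp]
              exact ⟨hP, hPP ▸ hT0⟩)
          (by simpa using hch)
        simpa using this
    rw [second, add_zero]
    by_cases hLn : L = []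
    · refine hT4 _ (fun b hb => ?_) _
      refine h.list_prod_mul h1 hb R ?_ (fun p hp => (hR p hp).1) (fun p hp => (hR p hp).2) ?_
      · rintro rfl
        simp [hLn] at hlen
      · simpa [hLn] using hch
    · rw [hT3]
      · rfl
      · intro b hb
        rw [fst_list_prod (B := fun i => (B i).toSubalgebra) L
          fun p hp => (hL p (by simp [hp])).1]
        have := h.mul_list_prod h1 hb (L.map fun p => (p.1, (p.2 (1, 0)).1)) (by simpa using hLn)
          (by
            intro p hp
            obtain ⟨q, hq, rfl⟩ := List.mem_map.1 hp
            exact fst_mem_of_mem_localOps (hL q (by simp [hq])).1)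
          (by
            intro p hp
            obtain ⟨q, hq, rfl⟩ := List.mem_map.1 hp
            exact (hL q (by simp [hq])).2)
          (by simpa [Function.comp_def] using hch.right_of_append)
        simpa [Function.comp_def] using this

/-- The alternating products of centered operators from the subalgebras `T i`. -/
def alternatingProducts (φ : A →ₗ[ℂ] ℂ)
    (T : ι → Subalgebra ℂ (Module.End ℂ (A × Module.Dual ℂ A))) :
    Set (Module.End ℂ (A × Module.Dual ℂ A)) :=
  {U | ∃ L : List (ι × Module.End ℂ (A × Module.Dual ℂ A)),
    (∀ p ∈ L, p.2 ∈ T p.1 ∧ φ (p.2 (1, 0)).1 = 0) ∧ (L.map Prod.fst).IsChain (· ≠ ·) ∧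
      U = (L.map Prod.snd).prod}

theorem mul_list_prod_mem_span_alternatingProducts (h1 : φ 1 = 1)
    {T : ι → Subalgebra ℂ (Module.End ℂ (A × Module.Dual ℂ A))} {i : ι}
    {U : Module.End ℂ (A × Module.Dual ℂ A)} (hU : U ∈ T i)
    (L : List (ι × Module.End ℂ (A × Module.Dual ℂ A)))
    (hL : ∀ p ∈ L, p.2 ∈ T p.1 ∧ φ (p.2 (1, 0)).1 = 0)
    (hch : (i :: L.map Prod.fst).IsChain (· ≠ ·)) :
    U * (L.map Prod.snd).prod ∈ Submodule.span ℂ (alternatingProducts φ T) := by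
  set c : ℂ := φ (U (1, 0)).1 with hc
  have e : U * (L.map Prod.snd).prod = (U - c • 1) * (L.map Prod.snd).prod
      + c • (L.map Prod.snd).prod := by simp [sub_mul]
  rw [e]
  refine add_mem (Submodule.subset_span ⟨(i, U - c • 1) :: L, ?_, by simpa using hch, by simp⟩)
    (Submodule.smul_mem _ _ (Submodule.subset_span ⟨L, hL, hch.tail, rfl⟩))
  intro p hp
  rcases List.mem_cons.1 hp with rfl | hp
  · refine ⟨sub_mem hU ((T i).smul_mem (one_mem _) _), ?_⟩
    simp [h1, hc]
  · exact hL p hp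

theorem mul_mem_span_alternatingProducts (h1 : φ 1 = 1)
    {T : ι → Subalgebra ℂ (Module.End ℂ (A × Module.Dual ℂ A))} {i : ι}
    {U W : Module.End ℂ (A × Module.Dual ℂ A)} (hU : U ∈ T i)
    (hW : W ∈ Submodule.span ℂ (alternatingProducts φ T)) :
    U * W ∈ Submodule.span ℂ (alternatingProducts φ T) := by
  induction hW using Submodule.span_induction with
  | zero => simp
  | add x y _ _ hx hy => rw [mul_add]; exact add_mem hx hy
  | smul c x _ hx => rw [mul_smul_comm]; exact Submodule.smul_mem _ _ hx
  | mem W hW =>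
    obtain ⟨L, hL, hch, rfl⟩ := hW
    cases L with
    | nil => exact mul_list_prod_mem_span_alternatingProducts h1 hU [] hL (by simp)
    | cons p L =>
      by_cases hip : i = p.1
      · subst hip
        rw [List.map_cons, List.prod_cons, ← mul_assoc]
        exact mul_list_prod_mem_span_alternatingProducts h1 (mul_mem hU (hL p (by simp)).1) L
          (fun q hq => hL q (by simp [hq])) (by simpa using hch)
      · refine mul_list_prod_mem_span_alternatingProducts h1 hU _ hL ?_
        rw [List.map_cons] at hch ⊢
        exact List.IsChain.cons_cons hip hch

/-- Schwinger-Dyson equations pass to free products: if `φ(y P) = v (φ ⊗ φ)(∂P)` holds for `P` in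
the algebra of a centered element `y`, and `∂` vanishes on the other, free, algebras, then it holds
on the algebra generated by all of them. -/
theorem FreelyIndependent.schwingerDyson (h1 : φ 1 = 1) (h : FreelyIndependent φ B)
    {T : ι → Subalgebra ℂ (Module.End ℂ (A × Module.Dual ℂ A))}
    (hT : ∀ i, T i ≤ localOps φ (B i).toSubalgebra) {i₀ : ι} {y : A} (hy : y ∈ B i₀)
    (hy0 : φ y = 0) (v : ℂ)
    (hloc : ∀ U ∈ T i₀, φ (y * (U (1, 0)).1) = v * (U (1, 0)).2 1)
    (hother : ∀ i, i ≠ i₀ → ∀ U ∈ T i, (U (1, 0)).2 = 0)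
    {U : Module.End ℂ (A × Module.Dual ℂ A)}
    (hU : U ∈ Algebra.adjoin ℂ (⋃ i, (T i : Set (Module.End ℂ (A × Module.Dual ℂ A))))) :
    φ (y * (U (1, 0)).1) = v * (U (1, 0)).2 1 := by
  have hspan : U ∈ Submodule.span ℂ (alternatingProducts φ T) := by
    have : ∀ W ∈ Submodule.span ℂ (alternatingProducts φ T),
        U * W ∈ Submodule.span ℂ (alternatingProducts φ T) := by
      induction hU using Algebra.adjoin_induction with
      | mem U hU =>
        obtain ⟨i, hi⟩ := Set.mem_iUnion.1 hU
        exact fun W hW => mul_mem_span_alternatingProducts h1 hi hW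
      | algebraMap c =>
        intro W hW
        rw [← Algebra.smul_def]
        exact Submodule.smul_mem _ _ hW
      | add x y _ _ hx hy => exact fun W hW => by rw [add_mul]; exact add_mem (hx W hW) (hy W hW)
      | mul x y _ _ hx hy => exact fun W hW => by rw [mul_assoc]; exact hx _ (hy W hW)
    have h1' := this 1 (Submodule.subset_span ⟨[], by simp, by simp, by simp⟩)
    rwa [mul_one] at h1'
  clear hU
  induction hspan using Submodule.span_induction with
  | zero => simp
  | add x y _ _ hx hy => simp [mul_add, hx, hy]
  | smul c x _ hx => simp [hx, mul_left_comm]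
  | mem W hW =>
    obtain ⟨L, hL, hch, rfl⟩ := hW
    have hLl : ∀ p ∈ L, p.2 ∈ localOps φ (B p.1).toSubalgebra := fun p hp => hT _ (hL p hp).1
    have hfst := fst_list_prod (B := fun i => (B i).toSubalgebra) L hLl
    -- `ev M` is the list of the elements of `A` computed by the operators of `M`
    let ev : List (ι × Module.End ℂ (A × Module.Dual ℂ A)) → List (ι × A) :=
      fun M => M.map fun p => (p.1, (p.2 (1, 0)).1)
    have hev : ∀ M, ((ev M).map Prod.snd).prod = (M.map fun p => (p.2 (1, 0)).1).prod :=
      fun M => by simp [ev, Function.comp_def]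
    have hevf : ∀ M, (ev M).map Prod.fst = M.map Prod.fst :=
      fun M => by simp [ev, Function.comp_def]
    have hmem : ∀ p ∈ ev L, p.2 ∈ B p.1 ∧ φ p.2 = 0 := by
      intro p hp
      obtain ⟨q, hq, rfl⟩ := List.mem_map.1 hp
      exact ⟨fst_mem_of_mem_localOps (hLl q hq), (hL q hq).2⟩
    match L with
    | [] => simp [hy0]
    | [p] =>
      by_cases hp : p.1 = i₀
      · obtain ⟨i, W⟩ := p
        subst hp
        simpa using hloc W (hL (i, W) (by simp)).1
      · have e1 := hother _ hp p.2 (hL p (by simp)).1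
        have e2 := h.mul_list_prod h1 hy (ev [p]) (by simp [ev]) (fun p hp => (hmem p hp).1)
          (fun p hp => (hmem p hp).2) (by simpa [hevf] using Ne.symm hp)
        simp only [ev] at e2
        simp only [List.map_cons, List.map_nil, List.prod_cons, List.prod_nil, mul_one] at e2 ⊢
        rw [e1, e2]
        simp
    | p :: p' :: L =>
      have e1 := h.snd_list_prod h1 (p :: p' :: L) [] (by simp)
        (fun q hq => ⟨hLl q hq, (hL q hq).2⟩) (by simp) (by simpa using hch)
      simp only [List.map_nil, List.prod_nil] at e1
      rw [e1, mul_zero, hfst]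
      by_cases hp : p.1 = i₀
      · have hyp : y * (p.2 (1, 0)).1 ∈ B i₀ :=
          mul_mem hy (hp ▸ fst_mem_of_mem_localOps (hLl p (by simp)))
        have e2 := h.mul_list_prod h1 hyp (ev (p' :: L)) (by simp [ev])
          (fun q hq => (hmem q (by simp [ev] at hq ⊢; tauto)).1)
          (fun q hq => (hmem q (by simp [ev] at hq ⊢; tauto)).2)
          (by rw [hevf, ← hp]; simpa using hch)
        rw [hev] at e2
        rw [List.map_cons, List.prod_cons, ← mul_assoc, e2]
      · have e2 := h.mul_list_prod h1 hy (ev (p :: p' :: L)) (by simp [ev])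
          (fun q hq => (hmem q hq).1) (fun q hq => (hmem q hq).2)
          (by
            rw [hevf]
            rw [List.map_cons] at hch ⊢
            exact List.IsChain.cons_cons (Ne.symm hp) hch)
        rw [hev] at e2
        exact e2

end SchwingerDyson

/-! ### Free cumulants of a quadratic form in free semicircular elements -/

section Quadratic

open Finset.HasAntidiagonal

variable {A : Type*} [CStarAlgebra A] {φ : A →ₗ[ℂ] ℂ}

theorem freeCumulant_zero (h1 : φ 1 = 1) (x : A) : freeCumulant φ x 0 = 1 := by
  rw [freeCumulant]
  simp [h1]

/-- The moment-cumulant recursion determines the free cumulants. -/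
theorem freeCumulant_eq_of_moment_eq_sum (h1 : φ 1 = 1) (x : A) (c : ℕ → ℂ)
    (hc : ∀ n, φ (x ^ n) = ∑ s ∈ Finset.range (n + 1),
      c s * PowerSeries.coeff (n - s) (momentSeries φ x ^ s)) (n : ℕ) :
    freeCumulant φ x n = c n := by
  induction n using Nat.strong_induction_on with
  | _ n ih =>
    have h2 := (moment_eq_sum_freeCumulant φ h1 x n).symm.trans (hc n)
    rw [Finset.sum_range_succ, Finset.sum_range_succ, Finset.sum_congr rfl fun s hs => by
      rw [ih s (Finset.mem_range.1 hs)]] at h2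
    have h3 : PowerSeries.coeff (n - n) (momentSeries φ x ^ n) = 1 := by
      simp [momentSeries, h1]
    rw [h3] at h2
    simpa using h2

variable {N : ℕ} (a : A) (x : Fin N → A) (C : Matrix (Fin N) (Fin N) ℂ)

/-- The element `a + ∑ C_{pq} x_p x_q`. -/
def quadraticElement : A := a + ∑ p, ∑ q, C p q • (x p * x q)

variable (φ) in
/-- The operator computing `quadraticElement` and its free difference quotient, for the derivation
with `∂a = c₀ (1 ⊗ 1)` and `∂x_p = c_p (1 ⊗ 1)`. -/
noncomputable def quadraticOp (c₀ : ℂ) (c : Fin N → ℂ) : Module.End ℂ (A × Module.Dual ℂ A) :=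
  diffLetter φ a c₀ + ∑ p, ∑ q, C p q • (diffLetter φ (x p) (c p) * diffLetter φ (x q) (c q))

variable (φ) in
/-- The value of `φ ⊗ φ` on `(z ⊗ 1) ∂(a + ∑ C_{pq} x_p x_q) (1 ⊗ q)`. -/
noncomputable def quadraticDiff (c₀ : ℂ) (c : Fin N → ℂ) (q z : A) : ℂ :=
  c₀ * (φ q * φ z) +
    ∑ i, ∑ j, C i j * (c i * (φ (x j * q) * φ z) + c j * (φ q * φ (z * x i)))

theorem quadraticOp_fst (c₀ : ℂ) (c : Fin N → ℂ) (u : A × Module.Dual ℂ A) :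
    (quadraticOp φ a x C c₀ c u).1 = quadraticElement a x C * u.1 := by
  simp [quadraticOp, quadraticElement, LinearMap.sum_apply, Prod.fst_sum, add_mul, Finset.sum_mul,
    mul_assoc]

theorem quadraticOp_snd (c₀ : ℂ) (c : Fin N → ℂ) (u : A × Module.Dual ℂ A) (z : A) :
    (quadraticOp φ a x C c₀ c u).2 z =
      quadraticDiff φ x C c₀ c u.1 z + u.2 (z * quadraticElement a x C) := by
  simp only [quadraticOp, quadraticElement, quadraticDiff, LinearMap.add_apply,
    LinearMap.sum_apply, Prod.snd_add, Prod.snd_sum, LinearMap.smul_apply, Prod.smul_snd,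
    Module.End.mul_apply, diffLetter_snd, diffLetter_fst, mul_add, Finset.mul_sum, map_add, map_sum,
    mul_smul_comm, map_smul, smul_eq_mul, Finset.sum_add_distrib, mul_assoc]
  ring

theorem quadraticOp_pow_fst (c₀ : ℂ) (c : Fin N → ℂ) (k : ℕ) (u : A × Module.Dual ℂ A) :
    ((quadraticOp φ a x C c₀ c ^ k) u).1 = quadraticElement a x C ^ k * u.1 := by
  induction k with
  | zero => simp
  | succ k ih => rw [pow_succ', Module.End.mul_apply, quadraticOp_fst, ih, pow_succ', mul_assoc]

/-- The Leibniz rule for the free difference quotient of a power. -/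
theorem quadraticOp_pow_succ_snd (c₀ : ℂ) (c : Fin N → ℂ) (k : ℕ) (u : A × Module.Dual ℂ A)
    (z : A) :
    ((quadraticOp φ a x C c₀ c ^ (k + 1)) u).2 z =
      ∑ p ∈ antidiagonal k, quadraticDiff φ x C c₀ c (quadraticElement a x C ^ p.2 * u.1)
        (z * quadraticElement a x C ^ p.1) + u.2 (z * quadraticElement a x C ^ (k + 1)) := by
  induction k generalizing z with
  | zero => simp [quadraticOp_snd]
  | succ k ih =>
    rw [pow_succ', Module.End.mul_apply, quadraticOp_snd, quadraticOp_pow_fst, ih,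
      Finset.Nat.sum_antidiagonal_succ]
    simp only [pow_zero, mul_one]
    simp only [mul_assoc, ← pow_succ', add_assoc]

variable (φ) in
/-- The Schwinger-Dyson equations `φ(a P) = v₀ (φ ⊗ φ)(∂_a P)` and
`φ(x_j P) = v_j (φ ⊗ φ)(∂_j P)`, for `P` in algebras containing `a` and all the `x_p`. -/
structure SchwingerDysonSystem (v₀ : ℂ) (v : Fin N → ℂ) : Prop where
  base : ∃ 𝓤 : Subalgebra ℂ (Module.End ℂ (A × Module.Dual ℂ A)), diffLetter φ a 1 ∈ 𝓤 ∧
    (∀ p, diffLetter φ (x p) 0 ∈ 𝓤) ∧ ∀ U ∈ 𝓤, φ (a * (U (1, 0)).1) = v₀ * (U (1, 0)).2 1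
  var : ∀ j, ∃ 𝓤 : Subalgebra ℂ (Module.End ℂ (A × Module.Dual ℂ A)), diffLetter φ a 0 ∈ 𝓤 ∧
    (∀ p, diffLetter φ (x p) (if p = j then 1 else 0) ∈ 𝓤) ∧
    ∀ U ∈ 𝓤, φ (x j * (U (1, 0)).1) = v j * (U (1, 0)).2 1

theorem quadraticOp_mem {𝓤 : Subalgebra ℂ (Module.End ℂ (A × Module.Dual ℂ A))} {c₀ : ℂ}
    {c : Fin N → ℂ} (ha : diffLetter φ a c₀ ∈ 𝓤) (hx : ∀ p, diffLetter φ (x p) (c p) ∈ 𝓤) :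
    quadraticOp φ a x C c₀ c ∈ 𝓤 :=
  add_mem ha (sum_mem fun p _ => sum_mem fun q _ => 𝓤.smul_mem (mul_mem (hx p) (hx q)) _)

variable {a x} {v₀ : ℂ} {v : Fin N → ℂ}

namespace SchwingerDysonSystem

theorem map_base (h : SchwingerDysonSystem φ a x v₀ v) : φ a = 0 := by
  obtain ⟨𝓤, -, -, hU⟩ := h.base
  simpa using hU 1 (one_mem _)

theorem map_base_mul_pow_succ (h : SchwingerDysonSystem φ a x v₀ v) (k : ℕ) :
    φ (a * quadraticElement a x C ^ (k + 1)) = v₀ * ∑ p ∈ antidiagonal k,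
      φ (quadraticElement a x C ^ p.2) * φ (quadraticElement a x C ^ p.1) := by
  obtain ⟨𝓤, ha, hx, hU⟩ := h.base
  have := hU (quadraticOp φ a x C 1 0 ^ (k + 1)) (pow_mem (quadraticOp_mem a x C ha hx) _)
  rw [quadraticOp_pow_fst, quadraticOp_pow_succ_snd] at this
  simpa [quadraticDiff] using this

theorem map_var (h : SchwingerDysonSystem φ a x v₀ v) (j : Fin N) : φ (x j) = 0 := by
  obtain ⟨𝓤, -, -, hU⟩ := h.var j
  simpa using hU 1 (one_mem _)

/-- Words with an odd number of the `x_p` have expectation zero. -/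
theorem map_var_mul_pow (htr : ∀ x y : A, φ (x * y) = φ (y * x))
    (h : SchwingerDysonSystem φ a x v₀ v) (k : ℕ) (j : Fin N) :
    φ (x j * quadraticElement a x C ^ k) = 0 := by
  induction k using Nat.strong_induction_on generalizing j with
  | _ k ih =>
    cases k with
    | zero => simpa using h.map_var j
    | succ k =>
      obtain ⟨𝓤, ha, hx, hU⟩ := h.var j
      have := hU (quadraticOp φ a x C 0 (fun p => if p = j then 1 else 0) ^ (k + 1))
        (pow_mem (quadraticOp_mem a x C ha hx) _)
      rw [quadraticOp_pow_fst, quadraticOp_pow_succ_snd] at this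
      simp only [mul_one, one_mul, LinearMap.zero_apply, add_zero] at this
      rw [this, Finset.sum_eq_zero, mul_zero]
      intro p hp
      rw [mem_antidiagonal] at hp
      rw [quadraticDiff, zero_mul, zero_add]
      refine Finset.sum_eq_zero fun i _ => Finset.sum_eq_zero fun l _ => ?_
      rw [htr _ (x i), ih p.2 (by omega) l, ih p.1 (by omega) i]
      ring

theorem map_var_mul_var (h1 : φ 1 = 1) (h : SchwingerDysonSystem φ a x v₀ v) (j p : Fin N) :
    φ (x j * x p) = v j * if p = j then 1 else 0 := by
  obtain ⟨𝓤, -, hx, hU⟩ := h.var j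
  have := hU _ (hx p)
  simpa [h1] using this

theorem map_var_mul_pow_succ_mul_var (h1 : φ 1 = 1) (htr : ∀ x y : A, φ (x * y) = φ (y * x))
    (h : SchwingerDysonSystem φ a x v₀ v) (k : ℕ) (j p : Fin N) :
    φ (x j * quadraticElement a x C ^ (k + 1) * x p) =
      v j * ((if p = j then 1 else 0) * φ (quadraticElement a x C ^ (k + 1)) +
        ∑ r ∈ antidiagonal k, φ (quadraticElement a x C ^ r.1) *
          ∑ q, C j q * φ (x q * quadraticElement a x C ^ r.2 * x p)) := by
  obtain ⟨𝓤, ha, hx, hU⟩ := h.var j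
  have := hU (quadraticOp φ a x C 0 (fun p => if p = j then 1 else 0) ^ (k + 1) *
    diffLetter φ (x p) (if p = j then 1 else 0))
    (mul_mem (pow_mem (quadraticOp_mem a x C ha hx) _) (hx p))
  rw [Module.End.mul_apply, quadraticOp_pow_fst, quadraticOp_pow_succ_snd] at this
  simp only [diffLetter_fst, mul_one, one_mul, diffLetter_snd, h1, LinearMap.zero_apply, add_zero,
    ← mul_assoc] at this
  rw [this, add_comm (∑ _ ∈ _, _)]
  congr 2
  refine Finset.sum_congr rfl fun r _ => ?_
  have hz : ∀ i, φ (quadraticElement a x C ^ r.1 * x i) = 0 := fun i => by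
    rw [htr, h.map_var_mul_pow C htr]
  simp only [quadraticDiff, zero_mul, zero_add, hz, mul_zero, add_zero]
  rw [Finset.sum_eq_single j (fun i _ hi => by simp [hi]) (by simp), Finset.mul_sum]
  refine Finset.sum_congr rfl fun q _ => ?_
  simp only [if_true, one_mul, mul_assoc]
  ring

open PowerSeries in
/-- The matrix `∑ₖ (∑_j C_{ij} φ(x_j Yᵏ x_p))_{ip} zᵏ`. -/
noncomputable def resolventSeries (φ : A →ₗ[ℂ] ℂ) (a : A) (x : Fin N → A)
    (C : Matrix (Fin N) (Fin N) ℂ) : Matrix (Fin N) (Fin N) (PowerSeries ℂ) :=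
  Matrix.of fun i p => PowerSeries.mk fun k =>
    ∑ j, C i j * φ (x j * quadraticElement a x C ^ k * x p)

theorem resolventSeries_eq (h1 : φ 1 = 1) (htr : ∀ x y : A, φ (x * y) = φ (y * x))
    (h : SchwingerDysonSystem φ a x v₀ v) :
    resolventSeries φ a x C = momentSeries φ (quadraticElement a x C) •
        ((C * Matrix.diagonal v).map PowerSeries.C) +
      (PowerSeries.X * momentSeries φ (quadraticElement a x C)) •
        ((C * Matrix.diagonal v).map PowerSeries.C * resolventSeries φ a x C) := by
  have hc : ∀ i p k, PowerSeries.coeff k (((C * Matrix.diagonal v).map PowerSeries.C *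
      resolventSeries φ a x C) i p) = ∑ q, C i q * v q * ∑ l, C q l *
        φ (x l * quadraticElement a x C ^ k * x p) := by
    intro i p k
    rw [Matrix.mul_apply, map_sum]
    refine Finset.sum_congr rfl fun q _ => ?_
    rw [Matrix.map_apply, PowerSeries.coeff_C_mul, Matrix.mul_diagonal, resolventSeries,
      Matrix.of_apply, PowerSeries.coeff_mk]
  ext i p k
  rw [Matrix.add_apply, Matrix.smul_apply, Matrix.smul_apply, Matrix.map_apply, smul_eq_mul,
    smul_eq_mul, map_add, Matrix.mul_diagonal, PowerSeries.coeff_mul_C, mul_assoc PowerSeries.X,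
    momentSeries, PowerSeries.coeff_mk, resolventSeries, Matrix.of_apply, PowerSeries.coeff_mk,
    ← resolventSeries]
  cases k with
  | zero =>
    simp only [pow_zero, mul_one, h.map_var_mul_var h1, PowerSeries.coeff_zero_X_mul, h1, one_mul,
      add_zero]
    simp
  | succ k =>
    rw [PowerSeries.coeff_succ_X_mul, PowerSeries.coeff_mul]
    simp only [hc, h.map_var_mul_pow_succ_mul_var C h1 htr, PowerSeries.coeff_mk]
    simp only [mul_add, Finset.sum_add_distrib]
    congr 1
    · rw [Finset.sum_eq_single p (fun q _ hq => by simp [Ne.symm hq]) (by simp)]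
      simp only [if_true]
      ring
    · simp only [Finset.mul_sum]
      rw [Finset.sum_comm]
      refine Finset.sum_congr rfl fun r _ => Finset.sum_congr rfl fun q _ =>
        Finset.sum_congr rfl fun l _ => ?_
      ring

/-- The resolvent series, expanded to order `R`. -/
theorem resolventSeries_expand (h1 : φ 1 = 1) (htr : ∀ x y : A, φ (x * y) = φ (y * x))
    (h : SchwingerDysonSystem φ a x v₀ v) (R : ℕ) :
    resolventSeries φ a x C = ∑ r ∈ Finset.range R,
        (PowerSeries.X ^ r * momentSeries φ (quadraticElement a x C) ^ (r + 1)) •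
          ((C * Matrix.diagonal v).map PowerSeries.C) ^ (r + 1) +
      (PowerSeries.X ^ R * momentSeries φ (quadraticElement a x C) ^ R) •
        (((C * Matrix.diagonal v).map PowerSeries.C) ^ R * resolventSeries φ a x C) := by
  induction R with
  | zero => simp
  | succ R ih =>
    rw [Finset.sum_range_succ]
    conv_lhs => rw [ih, resolventSeries_eq C h1 htr h]
    rw [add_assoc]
    congr 1
    rw [mul_add, smul_add, mul_smul_comm, mul_smul_comm, smul_smul, smul_smul, ← pow_succ,
      ← mul_assoc _ _ (resolventSeries φ a x C), ← pow_succ]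
    congr 1
    · congr 1
      ring
    · congr 1
      ring

theorem momentSeries_eq (h1 : φ 1 = 1) (htr : ∀ x y : A, φ (x * y) = φ (y * x))
    (h : SchwingerDysonSystem φ a x v₀ v) :
    momentSeries φ (quadraticElement a x C) = 1 +
      PowerSeries.C v₀ * (PowerSeries.X ^ 2 * momentSeries φ (quadraticElement a x C) ^ 2) +
      PowerSeries.X * (resolventSeries φ a x C).trace := by
  ext n
  have hquad : ∀ k, φ (quadraticElement a x C ^ (k + 1)) =
      φ (a * quadraticElement a x C ^ k) +
        ∑ i, ∑ j, C i j * φ (x j * quadraticElement a x C ^ k * x i) := by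
    intro k
    have e : φ (quadraticElement a x C ^ (k + 1)) =
        φ ((a + ∑ i, ∑ j, C i j • (x i * x j)) * quadraticElement a x C ^ k) := by
      rw [pow_succ']
      rfl
    rw [e]
    simp only [add_mul, Finset.sum_mul, map_add, map_sum, smul_mul_assoc, map_smul, smul_eq_mul]
    congr 1
    refine Finset.sum_congr rfl fun i _ => Finset.sum_congr rfl fun j _ => ?_
    rw [htr _ (x i), mul_assoc]
  match n with
  | 0 => simp [momentSeries, h1]
  | 1 =>
    have := hquad 0
    simp only [pow_zero, mul_one, h.map_base] at this
    rw [map_add, map_add, PowerSeries.coeff_C_mul, PowerSeries.coeff_X_pow_mul',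
      PowerSeries.coeff_succ_X_mul]
    simp [momentSeries, resolventSeries, Matrix.trace, PowerSeries.coeff_one]
    simpa using this
  | k + 2 =>
    rw [map_add, map_add, PowerSeries.coeff_C_mul, PowerSeries.coeff_X_pow_mul,
      PowerSeries.coeff_succ_X_mul, sq, PowerSeries.coeff_mul]
    simp only [momentSeries, PowerSeries.coeff_mk, hquad (k + 1), h.map_base_mul_pow_succ,
      resolventSeries, Matrix.trace, Matrix.diag_apply, Matrix.of_apply, map_sum,
      PowerSeries.coeff_one]
    simp [mul_comm]

/-- The free cumulants of `a + ∑ C_{pq} x_p x_q`, where `a` and the `x_p` are free semicircular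
elements of variances `v₀` and `v_p`. -/
theorem freeCumulant_quadraticElement (h1 : φ 1 = 1) (htr : ∀ x y : A, φ (x * y) = φ (y * x))
    (h : SchwingerDysonSystem φ a x v₀ v) {r : ℕ} (hr : r ≠ 0) :
    freeCumulant φ (quadraticElement a x C) r =
      (if r = 2 then v₀ else 0) + ((C * Matrix.diagonal v) ^ r).trace := by
  rw [freeCumulant_eq_of_moment_eq_sum h1 _ (fun r => if r = 0 then 1 else
    (if r = 2 then v₀ else 0) + ((C * Matrix.diagonal v) ^ r).trace), if_neg hr]
  intro n
  set M := momentSeries φ (quadraticElement a x C) with hM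
  have hn : φ (quadraticElement a x C ^ n) = PowerSeries.coeff n M := by
    simp [hM, momentSeries]
  have htrace : ∀ r, (((C * Matrix.diagonal v).map PowerSeries.C) ^ r).trace =
      PowerSeries.C (((C * Matrix.diagonal v) ^ r).trace) := by
    intro r
    rw [← Matrix.map_pow, AddMonoidHom.map_trace]
  have key := momentSeries_eq C h1 htr h
  rw [resolventSeries_expand C h1 htr h n, ← hM] at key
  rw [hn]
  refine (congrArg (PowerSeries.coeff n) key).trans ?_
  simp only [Matrix.trace_add, Matrix.trace_sum, Matrix.trace_smul, htrace, smul_eq_mul, mul_add,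
    map_add, Finset.mul_sum, map_sum]
  rw [mul_assoc (PowerSeries.X ^ n), ← mul_assoc PowerSeries.X (PowerSeries.X ^ n), ← pow_succ',
    PowerSeries.coeff_X_pow_mul', if_neg (by omega), add_zero, Finset.sum_range_succ']
  have hterm : ∀ s, PowerSeries.coeff n (PowerSeries.X * (PowerSeries.X ^ s * M ^ (s + 1) *
      PowerSeries.C (((C * Matrix.diagonal v) ^ (s + 1)).trace))) =
      if s + 1 ≤ n then ((C * Matrix.diagonal v) ^ (s + 1)).trace *
        PowerSeries.coeff (n - (s + 1)) (M ^ (s + 1)) else 0 := by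
    intro s
    rw [← mul_assoc, ← mul_assoc, ← pow_succ', PowerSeries.coeff_mul_C,
      PowerSeries.coeff_X_pow_mul']
    split_ifs <;> ring
  simp only [hterm, Nat.add_eq_zero_iff, one_ne_zero, and_false, if_false, add_mul,
    Finset.sum_add_distrib, if_true, pow_zero, Nat.sub_zero, one_mul]
  rw [PowerSeries.coeff_C_mul, PowerSeries.coeff_X_pow_mul']
  have e1 : ∑ s ∈ Finset.range n, (if s + 1 = 2 then v₀ else 0) *
      PowerSeries.coeff (n - (s + 1)) (M ^ (s + 1)) =
      v₀ * if 2 ≤ n then PowerSeries.coeff (n - 2) (M ^ 2) else 0 := by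
    split_ifs with h2
    · rw [Finset.sum_eq_single 1]
      · simp
      · intro s _ hs
        rw [if_neg (by omega), zero_mul]
      · intro hs
        exact absurd (Finset.mem_range.2 (by omega)) hs
    · rw [mul_zero]
      refine Finset.sum_eq_zero fun s hs => ?_
      rw [if_neg (by have := Finset.mem_range.1 hs; omega), zero_mul]
  rw [e1, Finset.sum_congr rfl fun s hs => if_pos (Nat.succ_le_of_lt (Finset.mem_range.1 hs))]
  ring

end SchwingerDysonSystem

end Quadratic

/-! ### Schwinger-Dyson equations for a free Brownian motion and a free semicircular element -/

section FreeBrownianMotion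

open Finset.HasAntidiagonal

variable {A : Type*} [CStarAlgebra A] {φ : A →ₗ[ℂ] ℂ}

theorem diffLetter_pow_fst (x : A) (c : ℂ) (k : ℕ) (u : A × Module.Dual ℂ A) :
    ((diffLetter φ x c ^ k) u).1 = x ^ k * u.1 := by
  induction k with
  | zero => simp
  | succ k ih => rw [pow_succ', Module.End.mul_apply, diffLetter_fst, ih, pow_succ', mul_assoc]

theorem diffLetter_pow_succ_snd (x : A) (k : ℕ) (z : A) :
    ((diffLetter φ x 1 ^ (k + 1)) (1, 0)).2 z =
      ∑ p ∈ antidiagonal k, φ (x ^ p.2) * φ (z * x ^ p.1) := by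
  induction k generalizing z with
  | zero => simp
  | succ k ih =>
    rw [pow_succ', Module.End.mul_apply, diffLetter_snd, diffLetter_pow_fst, ih,
      Finset.Nat.sum_antidiagonal_succ]
    simp only [pow_zero, mul_one, one_mul, mul_assoc, ← pow_succ']

/-- The Schwinger-Dyson equation of a single semicircular element. -/
theorem HasLaw.schwingerDyson {x : A} {v : ℝ} (hx : HasLaw φ x (semicircularLaw v)) (hv : 0 ≤ v)
    {U : Module.End ℂ (A × Module.Dual ℂ A)} (hU : U ∈ Algebra.adjoin ℂ {diffLetter φ x 1}) :
    φ (x * (U (1, 0)).1) = v * (U (1, 0)).2 1 := by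
  rw [Algebra.adjoin_singleton_eq_range_aeval] at hU
  obtain ⟨p, rfl⟩ := hU
  induction p using Polynomial.induction_on' with
  | add p q hp hq =>
    simp only [AlgHom.toRingHom_eq_coe, RingHom.coe_coe, map_add, LinearMap.add_apply, Prod.fst_add,
      Prod.snd_add, mul_add] at hp hq ⊢
    rw [hp, hq]
  | monomial k c =>
    simp only [AlgHom.toRingHom_eq_coe, RingHom.coe_coe, Polynomial.aeval_monomial,
      ← Algebra.smul_def, LinearMap.smul_apply, Prod.smul_fst, Prod.smul_snd, mul_smul_comm,
      map_smul, diffLetter_pow_fst, mul_one, ← pow_succ', smul_eq_mul]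
    cases k with
    | zero => simp [hx.map_eq_zero]
    | succ k =>
      rw [diffLetter_pow_succ_snd, hx.moment_add_two hv, mul_left_comm]
      simp only [one_mul]
      congr 2
      exact Finset.sum_congr rfl fun p _ => mul_comm _ _

theorem snd_eq_zero_of_mem_adjoin {s : Set (Module.End ℂ (A × Module.Dual ℂ A))}
    (hs : ∀ U ∈ s, ∀ q, (U (q, 0)).2 = 0) {U : Module.End ℂ (A × Module.Dual ℂ A)}
    (hU : U ∈ Algebra.adjoin ℂ s) (q : A) : (U (q, 0)).2 = 0 := by
  induction hU using Algebra.adjoin_induction generalizing q with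
  | mem U hU => exact hs U hU q
  | algebraMap c => simp [Algebra.algebraMap_eq_smul_one]
  | add x y _ _ hx hy => simp [hx, hy]
  | mul x y _ _ hx hy =>
    have : y (q, 0) = ((y (q, 0)).1, 0) := Prod.ext rfl (hy q)
    rw [Module.End.mul_apply, this, hx]

theorem diffLetter_zero_snd (b q : A) : (diffLetter φ b 0 (q, 0)).2 = 0 := by
  ext z
  simp

variable {S : ℝ≥0 → A}

theorem IsFreeBrownianMotion.hasLaw_increment (hS : IsFreeBrownianMotion φ S) {t : ℕ → ℝ≥0}
    (ht : Monotone t) (j : ℕ) :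
    HasLaw φ (S (t (j + 1)) - S (t j)) (semicircularLaw ((t (j + 1) : ℝ) - t j)) :=
  hS.increment_law _ _ (ht j.le_succ)

theorem sub_coe_nonneg {t : ℕ → ℝ≥0} (ht : Monotone t) (j : ℕ) :
    0 ≤ (t (j + 1) : ℝ) - t j :=
  sub_nonneg.2 (NNReal.coe_le_coe.2 (ht j.le_succ))

theorem IsFreeBrownianMotion.schwingerDyson_increment (h1 : φ 1 = 1)
    (hS : IsFreeBrownianMotion φ S) {t : ℕ → ℝ≥0} (ht : Monotone t) (j : ℕ)
    {U : Module.End ℂ (A × Module.Dual ℂ A)} (hU : U ∈ Algebra.adjoin ℂ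
      (Set.range fun i => diffLetter φ (S (t (i + 1)) - S (t i)) (if i = j then 1 else 0))) :
    φ ((S (t (j + 1)) - S (t j)) * (U (1, 0)).1) =
      ((t (j + 1) : ℝ) - t j : ℝ) * (U (1, 0)).2 1 := by
  refine (hS.increment_free t ht).schwingerDyson (T := fun i => Algebra.adjoin ℂ
    {diffLetter φ (S (t (i + 1)) - S (t i)) (if i = j then 1 else 0)}) h1 (fun i => ?_) (i₀ := j)
    (StarAlgebra.self_mem_adjoin_singleton ℂ _) (hS.hasLaw_increment ht j).map_eq_zero _
    (fun U hU => ?_) (fun i hi U hU => ?_) ?_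
  · refine Algebra.adjoin_le (Set.singleton_subset_iff.2 ?_)
    exact diffLetter_mem_localOps φ
      (StarAlgebra.self_mem_adjoin_singleton ℂ (S (t (i + 1)) - S (t i))) _
  · rw [if_pos rfl] at hU
    exact (hS.hasLaw_increment ht j).schwingerDyson (sub_coe_nonneg ht j) hU
  · rw [if_neg hi] at hU
    refine snd_eq_zero_of_mem_adjoin ?_ hU 1
    rintro U rfl q
    exact diffLetter_zero_snd _ q
  · refine Algebra.adjoin_mono ?_ hU
    rintro _ ⟨i, rfl⟩
    exact Set.mem_iUnion.2 ⟨i, Algebra.self_mem_adjoin_singleton ℂ _⟩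

/-- A semicircular element that is free from a free Brownian motion, together with the increments of
the latter, satisfies the Schwinger-Dyson equations. -/
theorem IsFreeBrownianMotion.schwingerDysonSystem (h1 : φ 1 = 1)
    (hS : IsFreeBrownianMotion φ S) {a : A} {v₀ : ℝ} (hv₀ : 0 ≤ v₀)
    (ha : HasLaw φ a (semicircularLaw v₀)) (haS : FreelyIndependentOf φ a S) {t : ℕ → ℝ≥0}
    (ht : Monotone t) (N : ℕ) :
    SchwingerDysonSystem φ a (fun p : Fin N => S (t (p + 1)) - S (t p)) v₀
      fun p => ((t (p + 1) : ℝ) - t p : ℝ) := by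
  have hmemS : ∀ i, S (t (i + 1)) - S (t i) ∈ StarAlgebra.adjoin ℂ (Set.range S) := fun i =>
    sub_mem (StarAlgebra.subset_adjoin ℂ _ ⟨_, rfl⟩) (StarAlgebra.subset_adjoin ℂ _ ⟨_, rfl⟩)
  have hmema : a ∈ StarAlgebra.adjoin ℂ {a} := StarAlgebra.self_mem_adjoin_singleton ℂ a
  -- the operators on both sides, and the algebra they generate
  let T : ℂ → (ℕ → ℂ) → Fin 2 → Subalgebra ℂ (Module.End ℂ (A × Module.Dual ℂ A)) := fun c₀ c =>
    ![Algebra.adjoin ℂ {diffLetter φ a c₀},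
      Algebra.adjoin ℂ (Set.range fun i => diffLetter φ (S (t (i + 1)) - S (t i)) (c i))]
  have hT : ∀ c₀ c i, T c₀ c i ≤ localOps φ ((![StarAlgebra.adjoin ℂ {a},
      StarAlgebra.adjoin ℂ (Set.range S)] : Fin 2 → StarSubalgebra ℂ A) i).toSubalgebra := by
    intro c₀ c i
    fin_cases i
    · exact Algebra.adjoin_le (Set.singleton_subset_iff.2 (diffLetter_mem_localOps φ hmema _))
    · refine Algebra.adjoin_le ?_
      rintro _ ⟨i, rfl⟩
      exact diffLetter_mem_localOps φ (hmemS i) _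
  have hTa : ∀ c₀ c, diffLetter φ a c₀ ∈ Algebra.adjoin ℂ
      (⋃ i, (T c₀ c i : Set (Module.End ℂ (A × Module.Dual ℂ A)))) := fun c₀ c =>
    Algebra.subset_adjoin (Set.mem_iUnion.2 ⟨0, Algebra.self_mem_adjoin_singleton ℂ _⟩)
  have hTx : ∀ c₀ c i, diffLetter φ (S (t (i + 1)) - S (t i)) (c i) ∈ Algebra.adjoin ℂ
      (⋃ i, (T c₀ c i : Set (Module.End ℂ (A × Module.Dual ℂ A)))) := fun c₀ c i =>
    Algebra.subset_adjoin (Set.mem_iUnion.2 ⟨1, Algebra.subset_adjoin ⟨i, rfl⟩⟩)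
  refine ⟨⟨_, hTa 1 0, fun p => hTx 1 0 p, fun U hU => ?_⟩, fun j => ⟨_,
    hTa 0 (fun i => if i = j then 1 else 0), fun p => ?_, fun U hU => ?_⟩⟩
  · refine haS.schwingerDyson h1 (hT 1 0) (i₀ := 0) hmema ha.map_eq_zero _
      (fun U hU => ha.schwingerDyson hv₀ hU) (fun i hi U hU => ?_) hU
    obtain rfl : i = 1 := Fin.eq_one_of_ne_zero i hi
    refine snd_eq_zero_of_mem_adjoin ?_ hU 1
    rintro _ ⟨i, rfl⟩ q
    exact diffLetter_zero_snd _ q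
  · have := hTx 0 (fun i => if i = (j : ℕ) then 1 else 0) p
    simpa only [Fin.val_inj] using this
  · refine haS.schwingerDyson h1 (hT 0 _) (i₀ := 1) (hmemS j)
      (hS.hasLaw_increment ht j).map_eq_zero _
      (fun U hU => hS.schwingerDyson_increment h1 ht j hU) (fun i hi U hU => ?_) hU
    obtain rfl : i = 0 := by fin_cases i <;> simp_all
    refine snd_eq_zero_of_mem_adjoin ?_ hU 1
    rintro U rfl q
    exact diffLetter_zero_snd _ q

/-- The matrix of coefficients of a step kernel. -/
def StepKernel.matrix (g : StepKernel) : Matrix (Fin g.size) (Fin g.size) ℝ :=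
  Matrix.of fun i j => g.coeff i j

/-- The lengths of the intervals of a step kernel. -/
def StepKernel.length (g : StepKernel) (i : Fin g.size) : ℝ :=
  (g.time (i + 1) : ℝ) - g.time i

theorem StepKernel.length_nonneg (g : StepKernel) (i : Fin g.size) : 0 ≤ g.length i :=
  sub_coe_nonneg g.mono i

theorem StepKernel.add_integral_eq_quadraticElement (g : StepKernel) (a : A) (S : ℝ≥0 → A) :
    a + g.integral S = quadraticElement a
      (fun p : Fin g.size => S (g.time (p + 1)) - S (g.time p))
      (g.matrix.map ((↑) : ℝ → ℂ)) := by
  simp [StepKernel.integral, quadraticElement, Finset.sum_range, StepKernel.matrix]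

/-- The free cumulants of a semicircular element plus the double Wigner integral of a step kernel
that is free from it. -/
theorem IsFreeBrownianMotion.freeCumulant_add_integral (hφ : IsFaithfulTracialState φ)
    (hS : IsFreeBrownianMotion φ S) {a : A} {v₀ : ℝ} (hv₀ : 0 ≤ v₀)
    (ha : HasLaw φ a (semicircularLaw v₀)) (haS : FreelyIndependentOf φ a S) (g : StepKernel)
    {r : ℕ} (hr : r ≠ 0) :
    freeCumulant φ (a + g.integral S) r =
      (((if r = 2 then v₀ else 0) +
        ((g.matrix * Matrix.diagonal g.length) ^ r).trace : ℝ) : ℂ) := by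
  have h := hS.schwingerDysonSystem hφ.map_one hv₀ ha haS g.mono g.size
  rw [g.add_integral_eq_quadraticElement, h.freeCumulant_quadraticElement _ hφ.map_one hφ.trace hr]
  have e : (g.matrix.map ((↑) : ℝ → ℂ) * Matrix.diagonal
      fun p : Fin g.size => (((g.time (p + 1) : ℝ) - g.time p : ℝ) : ℂ)) =
      (g.matrix * Matrix.diagonal g.length).map Complex.ofRealHom := by
    rw [Matrix.map_mul, Matrix.diagonal_map (map_zero _)]
    rfl
  rw [e, ← Matrix.map_pow, ← AddMonoidHom.map_trace]
  push_cast
  congr 1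
  split_ifs <;> simp

theorem hasLaw_zero (h1 : φ 1 = 1) : HasLaw φ 0 (semicircularLaw 0) := by
  refine ⟨IsSelfAdjoint.zero A, fun k => ?_⟩
  rw [integral_pow_semicircularLaw]
  cases k with
  | zero =>
    rw [semicircleIntegral_zero, div_self (by positivity)]
    simp [h1]
  | succ k => simp

theorem freelyIndependentOf_zero (h1 : φ 1 = 1) (S : ℝ≥0 → A) : FreelyIndependentOf φ 0 S := by
  intro n i x hx h0 halt
  by_cases hi : ∃ k, i k = 0
  · obtain ⟨k, hk⟩ := hi
    have hxk := hx k
    rw [hk] at hxk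
    have hle : StarAlgebra.adjoin ℂ {(0 : A)} ≤ ⊥ :=
      StarAlgebra.adjoin_le (Set.singleton_subset_iff.2 (zero_mem _))
    obtain ⟨c, hc⟩ := StarSubalgebra.mem_bot.1 (hle hxk)
    have h0k := h0 k
    rw [← hc, Algebra.algebraMap_eq_smul_one, map_smul, h1, smul_eq_mul, mul_one] at h0k
    have hzero : (0 : A) ∈ List.ofFn x := by
      rw [List.mem_ofFn]
      exact ⟨k, by rw [← hc, h0k, map_zero]⟩
    rw [List.prod_eq_zero hzero, map_zero]
  · push Not at hi
    have hi1 : ∀ k, i k = 1 := fun k => Fin.eq_one_of_ne_zero _ (hi k)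
    cases n with
    | zero => simpa using h0 0
    | succ n => exact absurd ((hi1 _).trans (hi1 _).symm) (halt 0)

end FreeBrownianMotion

/-! ### Hilbert-Schmidt operators of square-integrable kernels -/

section Kernels

open scoped InnerProductSpace

theorem norm_sq_eq_integral {α : Type*} [MeasurableSpace α] {μ : Measure α} (u : Lp ℝ 2 μ) :
    ‖u‖ ^ 2 = ∫ x, u x ^ 2 ∂μ := by
  rw [← real_inner_self_eq_norm_sq, L2.inner_def]
  simp [sq]

theorem inner_eq_integral {α : Type*} [MeasurableSpace α] {μ : Measure α} (u v : Lp ℝ 2 μ) :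
    ⟪u, v⟫_ℝ = ∫ x, u x * v x ∂μ := by
  rw [L2.inner_def]
  simp [mul_comm]

theorem kernelOperator_ae (f : L2Plane) (g : L2Line) :
    kernelOperator f g =ᵐ[halfLine] fun x => ∫ y, f (x, y) * g y ∂halfLine :=
  (memLp_kernel_integral f g).coeFn_toLp

theorem kernelOperator_sub (f h : L2Plane) (g : L2Line) :
    kernelOperator (f - h) g = kernelOperator f g - kernelOperator h g := by
  refine Lp.ext ?_
  have hsub : ∀ᵐ x ∂halfLine, ∀ᵐ y ∂halfLine, (f - h : L2Plane) (x, y) = f (x, y) - h (x, y) :=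
    Measure.ae_ae_of_ae_prod (Lp.coeFn_sub f h)
  filter_upwards [kernelOperator_ae (f - h) g, kernelOperator_ae f g, kernelOperator_ae h g,
    Lp.coeFn_sub (kernelOperator f g) (kernelOperator h g), hsub, memLp_slice f, memLp_slice h]
    with x h1 h2 h3 h4 h5 h6 h7
  rw [h4, Pi.sub_apply, h1, h2, h3]
  refine Eq.trans ?_
    (integral_sub (h6.integrable_mul (Lp.memLp g)) (h7.integrable_mul (Lp.memLp g)))
  refine integral_congr_ae ?_
  filter_upwards [h5] with y hy
  rw [hy, sub_mul]

/-- Bessel's inequality for the slices of `f`, integrated: the Hilbert-Schmidt norm of `T_f` is at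
most `‖f‖`. -/
theorem sum_norm_kernelOperator_sq_le (f : L2Plane) {ι : Type*} [Fintype ι] {e : ι → L2Line}
    (he : Orthonormal ℝ e) : ∑ i, ‖kernelOperator f (e i)‖ ^ 2 ≤ ‖f‖ ^ 2 := by
  have hint : Integrable (fun p => f p ^ 2) (halfLine.prod halfLine) :=
    (memLp_two_iff_integrable_sq (Lp.memLp f).1).1 (Lp.memLp f)
  have hint' : ∀ u : L2Line, Integrable (fun x => u x ^ 2) halfLine := fun u =>
    (memLp_two_iff_integrable_sq (Lp.memLp u).1).1 (Lp.memLp u)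
  simp only [norm_sq_eq_integral]
  rw [← integral_finsetSum _ fun i _ => hint' _, integral_prod _ hint]
  refine integral_mono_ae (integrable_finsetSum _ fun i _ => hint' _) hint.integral_prod_left ?_
  have hT : ∀ᵐ x ∂halfLine, ∀ i, kernelOperator f (e i) x = ∫ y, f (x, y) * e i y ∂halfLine :=
    ae_all_iff.2 fun i => kernelOperator_ae f (e i)
  filter_upwards [hT, memLp_slice f] with x hx hsl
  have hB := he.sum_inner_products_le (x := hsl.toLp _) (s := Finset.univ)
  rw [norm_sq_eq_integral, integral_congr_ae (g := fun y => f (x, y) ^ 2) (by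
    filter_upwards [hsl.coeFn_toLp] with y hy
    rw [hy])] at hB
  refine le_trans (le_of_eq (Finset.sum_congr rfl fun i _ => ?_)) hB
  rw [hx i, inner_eq_integral, Real.norm_eq_abs, sq_abs]
  congr 1
  refine integral_congr_ae ?_
  filter_upwards [hsl.coeFn_toLp] with y hy
  rw [hy, mul_comm]

theorem norm_kernelOperator_le (f : L2Plane) (u : L2Line) :
    ‖kernelOperator f u‖ ≤ ‖f‖ * ‖u‖ := by
  by_cases hu : u = 0
  · simp [hu]
  have hn : 0 < ‖u‖ := norm_pos_iff.2 hu
  have he : Orthonormal ℝ fun _ : Unit => ‖u‖⁻¹ • u :=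
    ⟨fun _ => by rw [norm_smul, norm_inv, norm_norm, inv_mul_cancel₀ hn.ne'],
      fun i j hij => absurd (Subsingleton.elim i j) hij⟩
  have := sum_norm_kernelOperator_sq_le f he
  rw [Finset.univ_unique, Finset.sum_singleton, map_smul, norm_smul, norm_inv, norm_norm] at this
  have h2 := abs_le_of_sq_le_sq' this (norm_nonneg f)
  rw [inv_mul_eq_div, div_le_iff₀ hn] at h2
  exact h2.2

theorem memLp_mul_prod {u v : ℝ → ℝ} (hu : MemLp u 2 halfLine) (hv : MemLp v 2 halfLine) :
    MemLp (fun p : ℝ × ℝ => u p.1 * v p.2) 2 (halfLine.prod halfLine) := by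
  have hm : AEStronglyMeasurable (fun p : ℝ × ℝ => u p.1 * v p.2) (halfLine.prod halfLine) :=
    hu.1.comp_fst.mul hv.1.comp_snd
  rw [memLp_two_iff_integrable_sq hm]
  simp only [mul_pow]
  exact ((memLp_two_iff_integrable_sq hu.1).1 hu).mul_prod ((memLp_two_iff_integrable_sq hv.1).1 hv)

theorem isSymmetric_kernelOperator {f : L2Plane} (hf : IsSymm f) :
    (kernelOperator f).IsSymmetric := by
  intro g h
  have hint : Integrable (fun p : ℝ × ℝ => f p * (h p.1 * g p.2)) (halfLine.prod halfLine) :=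
    (Lp.memLp f).integrable_mul (memLp_mul_prod (Lp.memLp h) (Lp.memLp g))
  have e1 : ⟪kernelOperator f g, h⟫_ℝ =
      ∫ p, f p * (h p.1 * g p.2) ∂(halfLine.prod halfLine) := by
    rw [inner_eq_integral, integral_prod _ hint]
    refine integral_congr_ae ?_
    filter_upwards [kernelOperator_ae f g] with x hx
    rw [hx, ← integral_mul_const]
    congr 1
    ext y
    ring
  have e2 : ⟪g, kernelOperator f h⟫_ℝ =
      ∫ p, f p.swap * (h p.1 * g p.2) ∂(halfLine.prod halfLine) := by
    rw [← integral_prod_swap, inner_eq_integral, integral_prod]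
    · refine integral_congr_ae ?_
      filter_upwards [kernelOperator_ae f h] with x hx
      rw [hx, ← integral_const_mul]
      congr 1
      ext y
      simp
      ring
    · refine (Lp.memLp f).integrable_mul (memLp_mul_prod (Lp.memLp g) (Lp.memLp h)) |>.congr ?_
      filter_upwards with p
      simp [mul_comm]
  rw [e1, e2]
  refine integral_congr_ae ?_
  filter_upwards [hf] with p hp
  rw [hp]

open Polynomial in
/-- A symmetric operator of finite rank is annihilated by `x ∏ (x - l)`, the product over its
distinct non-zero eigenvalues, and these are finitely many. -/
theorem finite_eigenvalues_and_aeval_eq_zero {H : Type*} [NormedAddCommGroup H]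
    [InnerProductSpace ℝ H] {T : H →ₗ[ℝ] H} (hT : T.IsSymmetric)
    [FiniteDimensional ℝ (LinearMap.range T)] :
    ∃ hE : {l : ℝ | l ≠ 0 ∧ Module.End.HasEigenvalue T l}.Finite,
      aeval T (X * ∏ l ∈ hE.toFinset, (X - C l)) = 0 := by
  have hinv : ∀ v ∈ LinearMap.range T, T v ∈ LinearMap.range T := fun v _ => ⟨v, rfl⟩
  have hT' : (T.restrict hinv).IsSymmetric := hT.restrict_invariant hinv
  have hE : {l : ℝ | l ≠ 0 ∧ Module.End.HasEigenvalue T l}.Finite := by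
    refine (Module.End.finite_hasEigenvalue (f := T.restrict hinv)).subset ?_
    rintro l ⟨hl0, hl⟩
    obtain ⟨w, hw⟩ := hl.exists_hasEigenvector
    have hwr : w ∈ LinearMap.range T :=
      ⟨l⁻¹ • w, by rw [map_smul, hw.apply_eq_smul, smul_smul, inv_mul_cancel₀ hl0, one_smul]⟩
    refine Module.End.hasEigenvalue_of_hasEigenvector (x := ⟨w, hwr⟩)
      ⟨Module.End.mem_eigenspace_iff.2 (Subtype.ext ?_), fun h => hw.2 (congrArg Subtype.val h)⟩
    exact hw.apply_eq_smul
  refine ⟨hE, LinearMap.ext fun v => ?_⟩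
  set P : ℝ[X] := ∏ l ∈ hE.toFinset, (X - C l) with hP
  set b := hT'.eigenvectorBasis rfl with hb
  have hbP : ∀ i, aeval T P (b i : H) = 0 := by
    intro i
    have hTb : T (b i : H) = hT'.eigenvalues rfl i • (b i : H) := by
      exact congrArg Subtype.val (hT'.apply_eigenvectorBasis rfl i)
    have hne : (b i : H) ≠ 0 := fun h =>
      b.orthonormal.ne_zero i (Subtype.ext h)
    have hvec : Module.End.HasEigenvector T (hT'.eigenvalues rfl i) (b i : H) :=
      ⟨Module.End.mem_eigenspace_iff.2 hTb, hne⟩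
    rw [Module.End.aeval_apply_of_hasEigenvector hvec]
    have hroot : P.eval (hT'.eigenvalues rfl i) = 0 := by
      rw [hP, eval_prod]
      refine Finset.prod_eq_zero (i := hT'.eigenvalues rfl i) (hE.mem_toFinset.2
        ⟨fun h0 => hne ?_, Module.End.hasEigenvalue_of_hasEigenvector hvec⟩) (by simp)
      -- a vector of the range in the kernel of the symmetric operator `T` vanishes
      obtain ⟨u, hu⟩ := (b i).2
      rw [h0, zero_smul] at hTb
      have h1 : ⟪(b i : H), (b i : H)⟫_ℝ = 0 := by
        rw [← hu, hT u, hu, hTb, inner_zero_right]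
      exact inner_self_eq_zero.1 h1
    rw [hroot, zero_smul]
  have hw : ((∑ i, b.repr ⟨T v, v, rfl⟩ i • b i : LinearMap.range T) : H) = T v :=
    congrArg Subtype.val (b.sum_repr ⟨T v, v, rfl⟩)
  rw [mul_comm, map_mul, aeval_X, Module.End.mul_apply, LinearMap.zero_apply]
  rw [Submodule.coe_sum] at hw
  rw [← hw, map_sum]
  refine Finset.sum_eq_zero fun i _ => ?_
  rw [Submodule.coe_smul, map_smul, hbP, smul_zero]

end Kernels

/-! ### Step kernels as kernels of finite rank -/

section StepKernels

open scoped InnerProductSpace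

theorem mul_mul_pow_succ {R : Type*} [Monoid R] (x y : R) (r : ℕ) :
    (x * y) ^ (r + 1) = x * (y * x) ^ r * y := by
  induction r with
  | zero => simp
  | succ r ih => rw [pow_succ, ih, pow_succ (y * x)]; simp only [mul_assoc]

theorem trace_pow_eq_sum_eigenvalues {n : Type*} [Fintype n] [DecidableEq n] {B : Matrix n n ℝ}
    (hB : B.IsHermitian) (r : ℕ) : (B ^ r).trace = ∑ i, hB.eigenvalues i ^ r := by
  conv_lhs => rw [hB.spectral_theorem]
  rw [← map_pow, Unitary.conjStarAlgAut_apply, Matrix.trace_mul_cycle]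
  simp [Matrix.diagonal_pow, Matrix.trace]

namespace StepKernel

/-- The indicator function of the `i`-th interval of a step kernel. -/
noncomputable def ind (g : StepKernel) (i : Fin g.size) : ℝ → ℝ :=
  (Set.Ioc (g.time i : ℝ) (g.time (i + 1))).indicator 1

variable (g : StepKernel)

theorem toFun_eq_sum_ind (p : ℝ × ℝ) :
    g.toFun p = ∑ i, g.ind i p.1 * ∑ j, g.matrix i j * g.ind j p.2 := by
  simp only [toFun, Finset.sum_range, ind, matrix, Matrix.of_apply, Finset.mul_sum]
  refine Finset.sum_congr rfl fun i _ => Finset.sum_congr rfl fun j _ => ?_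
  ring

theorem ind_mul_ind (i j : Fin g.size) (x : ℝ) :
    g.ind i x * g.ind j x = if i = j then g.ind i x else 0 := by
  have key : ∀ i j : Fin g.size, i < j → g.ind i x * g.ind j x = 0 := by
    intro i j hij
    have h : (g.time (i + 1) : ℝ) ≤ g.time j := NNReal.coe_le_coe.2 (g.mono hij)
    by_cases hx : x ≤ g.time (i + 1)
    · rw [ind, ind, Set.indicator_of_notMem (s := Set.Ioc (g.time j : ℝ) _)
        (fun hm => absurd (hx.trans h) (not_le.2 hm.1)), mul_zero]
    · rw [ind, Set.indicator_of_notMem (fun hm => hx hm.2), zero_mul]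
  split_ifs with hij
  · subst hij
    by_cases hx : x ∈ Set.Ioc (g.time i : ℝ) (g.time (i + 1)) <;> simp [ind, hx]
  · rcases lt_or_gt_of_ne hij with h | h
    · exact key i j h
    · rw [mul_comm]
      exact key j i h

theorem sum_ind_mul_sum_ind (u w : Fin g.size → ℝ) (x : ℝ) :
    (∑ i, g.ind i x * u i) * (∑ i, g.ind i x * w i) = ∑ i, g.ind i x * (u i * w i) := by
  rw [Finset.sum_mul_sum]
  refine Finset.sum_congr rfl fun i _ => ?_
  rw [Finset.sum_eq_single i]
  · rw [mul_mul_mul_comm, ind_mul_ind, if_pos rfl]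
  · intro j _ hj
    rw [mul_mul_mul_comm, ind_mul_ind, if_neg (Ne.symm hj), zero_mul]
  · simp

theorem halfLine_Ioc (i : Fin g.size) :
    halfLine (Set.Ioc (g.time i : ℝ) (g.time (i + 1))) = ENNReal.ofReal (g.length i) := by
  rw [Measure.restrict_apply measurableSet_Ioc, Set.inter_eq_left.2, Real.volume_Ioc]
  · rfl
  · exact fun x hx => (g.time i).2.trans hx.1.le

theorem memLp_ind (p : ENNReal) (i : Fin g.size) : MemLp (g.ind i) p halfLine :=
  memLp_indicator_const p measurableSet_Ioc 1
    (Or.inr (by rw [halfLine_Ioc]; exact ENNReal.ofReal_ne_top))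

theorem integrable_ind (i : Fin g.size) : Integrable (g.ind i) halfLine :=
  memLp_one_iff_integrable.1 (g.memLp_ind 1 i)

theorem integral_ind (i : Fin g.size) : ∫ x, g.ind i x ∂halfLine = g.length i := by
  rw [ind, integral_indicator_one measurableSet_Ioc, Measure.real, halfLine_Ioc,
    ENNReal.toReal_ofReal (g.length_nonneg i)]

theorem memLp_toFun : MemLp g.toFun 2 (halfLine.prod halfLine) := by
  have e : g.toFun = fun p => ∑ i, ∑ j, g.matrix i j * (g.ind i p.1 * g.ind j p.2) := by
    ext p
    rw [toFun_eq_sum_ind]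
    simp only [Finset.mul_sum]
    refine Finset.sum_congr rfl fun i _ => Finset.sum_congr rfl fun j _ => ?_
    ring
  rw [e]
  exact memLp_finsetSum _ fun i _ => memLp_finsetSum _ fun j _ =>
    (memLp_mul_prod (g.memLp_ind 2 i) (g.memLp_ind 2 j)).const_mul _

/-- The square-integrable kernel given by a step kernel. -/
noncomputable def toLp : L2Plane := g.memLp_toFun.toLp _

theorem norm_toLp_sq : ‖g.toLp‖ ^ 2 = ∑ i, ∑ j, g.matrix i j ^ 2 * (g.length i * g.length j) := by
  rw [norm_sq_eq_integral]
  have e : (fun p => g.toLp p ^ 2) =ᵐ[halfLine.prod halfLine]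
      fun p => ∑ i, ∑ j, g.matrix i j ^ 2 * (g.ind i p.1 * g.ind j p.2) := by
    filter_upwards [g.memLp_toFun.coeFn_toLp] with p hp
    rw [toLp, hp, toFun_eq_sum_ind, sq, sum_ind_mul_sum_ind]
    refine Finset.sum_congr rfl fun i _ => ?_
    have := g.sum_ind_mul_sum_ind (g.matrix i) (g.matrix i) p.2
    simp only [mul_comm (g.ind _ p.2)] at this
    rw [this, Finset.mul_sum]
    refine Finset.sum_congr rfl fun j _ => ?_
    ring
  have hi : ∀ i j, Integrable (fun p : ℝ × ℝ => g.matrix i j ^ 2 * (g.ind i p.1 * g.ind j p.2))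
      (halfLine.prod halfLine) := fun i j =>
    ((g.integrable_ind i).mul_prod (g.integrable_ind j)).const_mul _
  rw [integral_congr_ae e, integral_finsetSum _ fun i _ => integrable_finsetSum _ fun j _ => hi i j]
  refine Finset.sum_congr rfl fun i _ => ?_
  rw [integral_finsetSum _ fun j _ => hi i j]
  refine Finset.sum_congr rfl fun j _ => ?_
  rw [integral_const_mul, integral_prod_mul, integral_ind, integral_ind]

theorem memLp_sum_ind (w : Fin g.size → ℝ) :
    MemLp (fun x => ∑ i, g.ind i x * w i) 2 halfLine :=
  memLp_finsetSum _ fun i _ => (g.memLp_ind 2 i).mul_const _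

/-- The step function with values `w`. -/
noncomputable def vec (w : Fin g.size → ℝ) : L2Line := (g.memLp_sum_ind w).toLp _

theorem vec_ae (w : Fin g.size → ℝ) : g.vec w =ᵐ[halfLine] fun x => ∑ i, g.ind i x * w i :=
  (g.memLp_sum_ind w).coeFn_toLp

theorem integral_sum_ind (w : Fin g.size → ℝ) :
    ∫ x, ∑ i, g.ind i x * w i ∂halfLine = ∑ i, g.length i * w i := by
  rw [integral_finsetSum _ fun i _ => (g.integrable_ind i).mul_const _]
  simp only [integral_mul_const, integral_ind]

theorem inner_vec (u w : Fin g.size → ℝ) :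
    ⟪g.vec u, g.vec w⟫_ℝ = ∑ i, g.length i * (u i * w i) := by
  rw [inner_eq_integral, ← integral_sum_ind]
  refine integral_congr_ae ?_
  filter_upwards [g.vec_ae u, g.vec_ae w] with x h1 h2
  rw [h1, h2, sum_ind_mul_sum_ind]

theorem kernelOperator_toLp_vec (w : Fin g.size → ℝ) :
    kernelOperator g.toLp (g.vec w) = g.vec fun i => ∑ j, g.matrix i j * (g.length j * w j) := by
  refine Lp.ext ?_
  have hg : ∀ᵐ x ∂halfLine, ∀ᵐ y ∂halfLine, g.toLp (x, y) = g.toFun (x, y) :=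
    Measure.ae_ae_of_ae_prod g.memLp_toFun.coeFn_toLp
  filter_upwards [kernelOperator_ae g.toLp (g.vec w), g.vec_ae _, hg] with x h1 h2 h3
  rw [h1, h2]
  have e : (fun y => g.toLp (x, y) * g.vec w y) =ᵐ[halfLine]
      fun y => ∑ j, g.ind j y * ((∑ i, g.ind i x * g.matrix i j) * w j) := by
    filter_upwards [h3, g.vec_ae w] with y hy hy'
    rw [hy, hy', ← sum_ind_mul_sum_ind, toFun_eq_sum_ind]
    congr 1
    simp only [Finset.mul_sum]
    rw [Finset.sum_comm]
    refine Finset.sum_congr rfl fun i _ => Finset.sum_congr rfl fun j _ => ?_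
    ring
  rw [integral_congr_ae e, integral_sum_ind]
  simp only [Finset.mul_sum, Finset.sum_mul]
  rw [Finset.sum_comm]
  refine Finset.sum_congr rfl fun i _ => Finset.sum_congr rfl fun j _ => ?_
  ring

/-- The spectral decomposition of a symmetric step kernel: an orthonormal family of eigenvectors
whose eigenvalues have the traces of the powers as power sums. -/
theorem exists_eigenvectors (hg : g.matrix.IsSymm) :
    ∃ (n : ℕ) (l : Fin n → ℝ) (e : Fin n → L2Line), Orthonormal ℝ e ∧
      (∀ i, kernelOperator g.toLp (e i) = l i • e i) ∧
      ∀ r : ℕ, r ≠ 0 → ((g.matrix * Matrix.diagonal g.length) ^ r).trace = ∑ i, l i ^ r := by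
  classical
  set d : Fin g.size → ℝ := fun i => √(g.length i) with hd
  have hdd : ∀ i, d i * d i = g.length i := fun i => Real.mul_self_sqrt (g.length_nonneg i)
  set B : Matrix (Fin g.size) (Fin g.size) ℝ :=
    Matrix.diagonal d * (g.matrix * Matrix.diagonal d) with hBdef
  have hB : B.IsHermitian := by
    rw [Matrix.IsHermitian, Matrix.conjTranspose_eq_transpose_of_trivial, hBdef,
      Matrix.transpose_mul, Matrix.transpose_mul, Matrix.diagonal_transpose, hg.eq, mul_assoc]
  have hBapp : ∀ i j, B i j = d i * (g.matrix i j * d j) := fun i j => by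
    rw [hBdef, Matrix.diagonal_mul, Matrix.mul_diagonal]
  -- eigenvectors with eigenvalue `0` are dropped: they need not give unit step functions
  let ι := {m // hB.eigenvalues m ≠ 0}
  let u : ι → Fin g.size → ℝ := fun m => hB.eigenvectorBasis m
  -- `w m = d⁻¹ u m`, written without dividing by the lengths, some of which may vanish
  let w : ι → Fin g.size → ℝ := fun m i =>
    (hB.eigenvalues m)⁻¹ * ∑ j, g.matrix i j * (d j * u m j)
  have hw : ∀ m i, d i * w m i = u m i := by
    intro m i
    have h1 := congrFun (hB.mulVec_eigenvectorBasis m) i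
    rw [Pi.smul_apply, smul_eq_mul] at h1
    change d i * ((hB.eigenvalues m)⁻¹ * _) = hB.eigenvectorBasis m i
    rw [mul_left_comm, inv_mul_eq_iff_eq_mul₀ m.2, ← h1, Matrix.mulVec, dotProduct, Finset.mul_sum]
    refine Finset.sum_congr rfl fun j _ => ?_
    rw [hBapp]
    simp only [u]
    ring
  have horth : Orthonormal ℝ fun m => g.vec (w m) := by
    rw [orthonormal_iff_ite]
    intro m n
    rw [inner_vec]
    have h1 := orthonormal_iff_ite.1 hB.eigenvectorBasis.orthonormal m n
    rw [EuclideanSpace.inner_eq_star_dotProduct, dotProduct] at h1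
    have hmn : m = n ↔ m.1 = n.1 := Subtype.ext_iff
    simp only [hmn]
    rw [← h1]
    refine Finset.sum_congr rfl fun i _ => ?_
    have e1 := hw m i
    have e2 := hw n i
    simp only [u] at e1 e2
    rw [← hdd, mul_mul_mul_comm, e1, e2]
    simp [mul_comm]
  have heig : ∀ m : ι, kernelOperator g.toLp (g.vec (w m)) = hB.eigenvalues m • g.vec (w m) := by
    intro m
    rw [kernelOperator_toLp_vec]
    have e : (fun i => ∑ j, g.matrix i j * (g.length j * w m j)) =
        fun i => hB.eigenvalues m * w m i := by
      ext i
      change _ = hB.eigenvalues m * ((hB.eigenvalues m)⁻¹ * _)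
      rw [mul_inv_cancel_left₀ m.2]
      refine Finset.sum_congr rfl fun j _ => ?_
      rw [← hdd, mul_assoc, hw]
    rw [e]
    refine Lp.ext ?_
    filter_upwards [g.vec_ae fun i => hB.eigenvalues m * w m i, g.vec_ae (w m),
      Lp.coeFn_smul (hB.eigenvalues m) (g.vec (w m))] with x h1 h2 h3
    rw [h1, h3, Pi.smul_apply, h2, smul_eq_mul, Finset.mul_sum]
    refine Finset.sum_congr rfl fun i _ => ?_
    ring
  have htr : ∀ r : ℕ, r ≠ 0 → ((g.matrix * Matrix.diagonal g.length) ^ r).trace =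
      ∑ m : ι, hB.eigenvalues m ^ r := by
    intro r hr
    obtain ⟨r, rfl⟩ := Nat.exists_eq_succ_of_ne_zero hr
    have e1 : g.matrix * Matrix.diagonal g.length =
        (g.matrix * Matrix.diagonal d) * Matrix.diagonal d := by
      rw [mul_assoc, Matrix.diagonal_mul_diagonal]
      simp only [hdd]
    have e2 : ((g.matrix * Matrix.diagonal g.length) ^ (r + 1)).trace = (B ^ (r + 1)).trace := by
      rw [e1, mul_mul_pow_succ, Matrix.trace_mul_comm, ← mul_assoc, ← hBdef, pow_succ']
    rw [Nat.succ_eq_add_one, e2, trace_pow_eq_sum_eigenvalues hB]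
    rw [← Finset.sum_filter_of_ne (p := fun m => hB.eigenvalues m ≠ 0)
      (fun m _ h h0 => h (by rw [h0, zero_pow r.succ_ne_zero]))]
    exact Finset.sum_subtype _ (by simp) _
  let E := Fintype.equivFin ι
  refine ⟨Fintype.card ι, fun i => hB.eigenvalues (E.symm i), fun i => g.vec (w (E.symm i)),
    horth.comp _ E.symm.injective, fun i => heig _, fun r hr => ?_⟩
  rw [htr r hr]
  exact (E.symm.sum_comp fun m : ι => hB.eigenvalues m ^ r).symm

end StepKernel

end StepKernels

/-! ### Moments and free cumulants of families -/

section MomentsCumulants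

open Finset.HasAntidiagonal

variable {A : Type*} [CStarAlgebra A] {φ : A →ₗ[ℂ] ℂ}

theorem coeff_momentSeries_pow_mem {K : Type*} (R : Subring (K → ℂ)) (X : K → A) {n : ℕ}
    (h : ∀ m ≤ n, (fun k => φ (X k ^ m)) ∈ R) (s : ℕ) :
    ∀ m ≤ n, (fun k => PowerSeries.coeff m (momentSeries φ (X k) ^ s)) ∈ R := by
  induction s with
  | zero =>
    intro m _
    simp only [pow_zero, PowerSeries.coeff_one]
    split_ifs
    · exact one_mem R
    · exact zero_mem R
  | succ s ih =>
    intro m hm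
    simp only [pow_succ, PowerSeries.coeff_mul]
    have e : (fun k => ∑ p ∈ antidiagonal m, PowerSeries.coeff p.1 (momentSeries φ (X k) ^ s) *
        PowerSeries.coeff p.2 (momentSeries φ (X k))) = ∑ p ∈ antidiagonal m,
        (fun k => PowerSeries.coeff p.1 (momentSeries φ (X k) ^ s)) * fun k => φ (X k ^ p.2) := by
      ext k
      simp [momentSeries]
    rw [e]
    refine sum_mem fun p hp => ?_
    rw [mem_antidiagonal] at hp
    exact mul_mem (ih _ (by omega)) (h _ (by omega))

/-- The moments of a family are polynomials in its free cumulants, so they lie in every ring of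
functions that contains the free cumulants. -/
theorem moment_mem_of_freeCumulant_mem (h1 : φ 1 = 1) {K : Type*} (R : Subring (K → ℂ)) (X : K → A)
    (h : ∀ r, (fun k => freeCumulant φ (X k) r) ∈ R) (n : ℕ) : (fun k => φ (X k ^ n)) ∈ R := by
  induction n using Nat.strong_induction_on with
  | _ n ih =>
    have e : (fun k => φ (X k ^ n)) = ∑ s ∈ Finset.range (n + 1),
        (fun k => freeCumulant φ (X k) s) *
          fun k => PowerSeries.coeff (n - s) (momentSeries φ (X k) ^ s) := by
      ext k
      rw [moment_eq_sum_freeCumulant φ h1]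
      simp
    rw [e]
    refine sum_mem fun s _ => mul_mem (h s) ?_
    cases s with
    | zero =>
      simp only [pow_zero, PowerSeries.coeff_one]
      split_ifs
      · exact one_mem R
      · exact zero_mem R
    | succ s =>
      cases n with
      | zero => exact coeff_momentSeries_pow_mem R X (n := 0) (fun m hm => by
          obtain rfl : m = 0 := by omega
          simp only [pow_zero, h1]
          exact one_mem R) _ _ (by omega)
      | succ n =>
        exact coeff_momentSeries_pow_mem R X (n := n) (fun m hm => ih m (by omega)) _ _ (by omega)

/-- The free cumulants of a family are polynomials in its moments, so they lie in every ring of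
functions that contains the moments. -/
theorem freeCumulant_mem_of_moment_mem {K : Type*} (R : Subring (K → ℂ)) (X : K → A)
    (h : ∀ n, (fun k => φ (X k ^ n)) ∈ R) (r : ℕ) : (fun k => freeCumulant φ (X k) r) ∈ R := by
  induction r using Nat.strong_induction_on with
  | _ r ih =>
    have e : (fun k => freeCumulant φ (X k) r) = (fun k => φ (X k ^ r)) - ∑ s : Fin r,
        (fun k => freeCumulant φ (X k) s) *
          fun k => PowerSeries.coeff (r - (s : ℕ)) (momentSeries φ (X k) ^ (s : ℕ)) := by
      ext k
      rw [freeCumulant]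
      simp
    rw [e]
    exact sub_mem (h r) (sum_mem fun s _ => mul_mem (ih s s.2)
      (coeff_momentSeries_pow_mem R X (n := r) (fun m _ => h m) _ _ (by omega)))

/-- The ring of bounded sequences. -/
def boundedSequences : Subring (ℕ → ℂ) where
  carrier := {f | ∃ B, ∀ k, ‖f k‖ ≤ B}
  zero_mem' := ⟨0, by simp⟩
  one_mem' := ⟨1, by simp⟩
  neg_mem' := by
    rintro f ⟨B, hB⟩
    exact ⟨B, by simpa using hB⟩
  add_mem' := by
    rintro f g ⟨B, hB⟩ ⟨B', hB'⟩
    exact ⟨B + B', fun k => (norm_add_le _ _).trans (add_le_add (hB k) (hB' k))⟩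
  mul_mem' := by
    rintro f g ⟨B, hB⟩ ⟨B', hB'⟩
    exact ⟨B * B', fun k => (norm_mul_le _ _).trans
      (mul_le_mul (hB k) (hB' k) (norm_nonneg _) ((norm_nonneg _).trans (hB k)))⟩

/-- The ring of convergent sequences, with their limits as the value at `none`. -/
def convergentSequences : Subring (Option ℕ → ℂ) where
  carrier := {f | Tendsto (fun k : ℕ => f (some k)) atTop (𝓝 (f none))}
  zero_mem' := tendsto_const_nhds
  one_mem' := tendsto_const_nhds
  neg_mem' := fun hf => Tendsto.neg hf
  add_mem' := fun hf hg => Tendsto.add hf hg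
  mul_mem' := fun hf hg => Tendsto.mul hf hg

theorem tendsto_freeCumulant {X : ℕ → A} {Y : A}
    (h : ∀ n, Tendsto (fun k => φ (X k ^ n)) atTop (𝓝 (φ (Y ^ n)))) (r : ℕ) :
    Tendsto (fun k => freeCumulant φ (X k) r) atTop (𝓝 (freeCumulant φ Y r)) :=
  freeCumulant_mem_of_moment_mem convergentSequences (fun k : Option ℕ => k.elim Y X) h r

theorem convergesInLaw_iff_freeCumulant (h1 : φ 1 = 1) {X : ℕ → A} {Y : A} :
    ConvergesInLaw φ X Y ↔
      ∀ r, Tendsto (fun k => freeCumulant φ (X k) r) atTop (𝓝 (freeCumulant φ Y r)) :=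
  ⟨fun h => tendsto_freeCumulant h, fun h =>
    moment_mem_of_freeCumulant_mem h1 convergentSequences (fun k : Option ℕ => k.elim Y X) h⟩

theorem map_sq_eq_freeCumulant_two (h1 : φ 1 = 1) {x : A} (h : freeCumulant φ x 1 = 0) :
    φ (x ^ 2) = freeCumulant φ x 2 := by
  rw [moment_eq_sum_freeCumulant φ h1]
  simp [Finset.sum_range_succ, h, PowerSeries.coeff_one, momentSeries, h1]

end MomentsCumulants

/-! ### The seminorm of a tracial state -/

section TracialState

variable {A : Type*} [CStarAlgebra A] {φ : A →ₗ[ℂ] ℂ}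

namespace IsFaithfulTracialState

theorem map_star_mul_self (hφ : IsFaithfulTracialState φ) (x : A) :
    φ (star x * x) = ((φ (star x * x)).re : ℂ) :=
  Complex.ext rfl (hφ.nonneg x).2

theorem map_star (hφ : IsFaithfulTracialState φ) (x : A) : φ (star x) = star (φ x) := by
  -- positivity at `y + 1` shows that `φ(y) + φ(y⋆)` is real; take `y = x` and `y = i x`
  have key : ∀ y : A, (φ (star y)).im + (φ y).im = 0 := by
    intro y
    have h1 := (hφ.nonneg (y + 1)).2
    have h2 := (hφ.nonneg y).2
    simp only [star_add, star_one, add_mul, mul_add, mul_one, one_mul, map_add, hφ.map_one,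
      Complex.add_im, h2, Complex.one_im] at h1
    linarith
  have h1 := key x
  have h2 := key (Complex.I • x)
  simp only [star_smul, map_smul, smul_eq_mul, Complex.mul_im, Complex.star_def, Complex.conj_I,
    Complex.neg_re, Complex.neg_im, Complex.I_re, Complex.I_im] at h2
  refine Complex.ext ?_ ?_
  · simp only [Complex.star_def, Complex.conj_re]
    linarith
  · simp only [Complex.star_def, Complex.conj_im]
    linarith

/-- The Cauchy-Schwarz inequality. -/
theorem norm_map_star_mul_sq_le (hφ : IsFaithfulTracialState φ) (x y : A) :
    ‖φ (star x * y)‖ ^ 2 ≤ (φ (star x * x)).re * (φ (star y * y)).re := by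
  let c : PreInnerProductSpace.Core ℂ A :=
    { inner := fun x y => φ (star x * y)
      conj_inner_symm := fun x y => by
        rw [← Complex.star_def, ← hφ.map_star, star_mul, star_star]
      re_inner_nonneg := fun x => (hφ.nonneg x).1
      add_left := fun x y z => by rw [star_add, add_mul, map_add]
      smul_left := fun x y r => by rw [star_smul, smul_mul_assoc, map_smul]; rfl }
  have h := InnerProductSpace.Core.inner_mul_inner_self_le (c := c) x y
  have e : ‖φ (star y * x)‖ = ‖φ (star x * y)‖ := by
    rw [← norm_star (φ (star x * y)), ← hφ.map_star, star_mul, star_star]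
  change ‖φ (star x * y)‖ * ‖φ (star y * x)‖ ≤ (φ (star x * x)).re * (φ (star y * y)).re at h
  rwa [e, ← sq] at h

theorem map_star_mul_self_add_le (hφ : IsFaithfulTracialState φ) (x y : A) :
    (φ (star (x + y) * (x + y))).re ≤
      2 * (φ (star x * x)).re + 2 * (φ (star y * y)).re := by
  have h := (hφ.nonneg (x - y)).1
  simp only [star_add, star_sub, add_mul, mul_add, sub_mul, mul_sub, map_add, map_sub,
    Complex.add_re, Complex.sub_re] at h ⊢
  linarith

/-- Convergence in `L²` of self-adjoint elements with bounded moments implies convergence of the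
moments. -/
theorem tendsto_moment (hφ : IsFaithfulTracialState φ) {Y : A} {Z : ℕ → A}
    (hY : IsSelfAdjoint Y) (hZ : ∀ k, IsSelfAdjoint (Z k))
    (hbdd : ∀ m, ∃ B, ∀ k, ‖φ (Z k ^ m)‖ ≤ B)
    (hlim : Tendsto (fun k => (φ (star (Y - Z k) * (Y - Z k))).re) atTop (𝓝 0)) (m : ℕ) :
    Tendsto (fun k => φ (Z k ^ m)) atTop (𝓝 (φ (Y ^ m))) := by
  -- Cauchy-Schwarz twice: `|φ(Yⁱ (Y - Z) Zʲ)|² ≤ ‖Y - Z‖² φ(Y⁴ⁱ)^(1/2) φ(Z⁴ʲ)^(1/2)`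
  have key : ∀ i j, Tendsto (fun k => φ (Y ^ i * (Y - Z k) * Z k ^ j)) atTop (𝓝 0) := by
    intro i j
    obtain ⟨B, hB⟩ := hbdd (2 * j + 2 * j)
    have h1 : ∀ k, ‖φ (Y ^ i * (Y - Z k) * Z k ^ j)‖ ^ 2 ≤
        (φ (star (Y - Z k) * (Y - Z k))).re * √((φ (Y ^ (2 * i + 2 * i))).re * B) := by
      intro k
      have hs : star (Y - Z k) = Y - Z k := ((hY.sub (hZ k)).star_eq)
      have e1 : φ (Y ^ i * (Y - Z k) * Z k ^ j) = φ (star (Y - Z k) * (Z k ^ j * Y ^ i)) := by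
        rw [mul_assoc, hφ.trace, hs, mul_assoc]
      have e2 : φ (star (Z k ^ j * Y ^ i) * (Z k ^ j * Y ^ i)) =
          φ (star (Y ^ (2 * i)) * Z k ^ (2 * j)) := by
        rw [star_mul, (hY.pow i).star_eq, ((hZ k).pow j).star_eq, (hY.pow (2 * i)).star_eq,
          mul_assoc, hφ.trace, two_mul, two_mul, pow_add, pow_add]
        rw [hφ.trace (Y ^ i * Y ^ i)]
        simp only [mul_assoc]
      have e3 := hφ.norm_map_star_mul_sq_le (Y ^ (2 * i)) (Z k ^ (2 * j))
      have e4 := (hφ.nonneg (Y ^ (2 * i))).1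
      rw [(hY.pow (2 * i)).star_eq, ((hZ k).pow (2 * j)).star_eq, ← pow_add, ← pow_add] at e3
      rw [(hY.pow (2 * i)).star_eq, ← pow_add] at e4
      rw [e1]
      refine (hφ.norm_map_star_mul_sq_le _ _).trans
        (mul_le_mul_of_nonneg_left ?_ (hφ.nonneg _).1)
      rw [e2, (hY.pow (2 * i)).star_eq]
      refine (Complex.re_le_norm _).trans (Real.le_sqrt_of_sq_le (e3.trans ?_))
      exact mul_le_mul_of_nonneg_left ((Complex.re_le_norm _).trans (hB k)) e4
    have h2 : Tendsto (fun k => ‖φ (Y ^ i * (Y - Z k) * Z k ^ j)‖ ^ 2) atTop (𝓝 0) := by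
      refine squeeze_zero (fun k => sq_nonneg _) h1 ?_
      simpa using hlim.mul_const _
    have h3 := h2.sqrt
    simp only [Real.sqrt_sq (norm_nonneg _), Real.sqrt_zero] at h3
    exact tendsto_zero_iff_norm_tendsto_zero.2 h3
  -- telescoping of `Yᵐ - Zᵐ`
  have key2 : ∀ m j, Tendsto (fun k => φ ((Y ^ m - Z k ^ m) * Z k ^ j)) atTop (𝓝 0) := by
    intro m
    induction m with
    | zero => simp
    | succ m ih =>
      intro j
      have := (key m j).add (ih (j + 1))
      rw [add_zero] at this
      refine this.congr fun k => ?_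
      rw [← map_add]
      congr 1
      rw [pow_succ' (Z k) j, pow_succ, pow_succ (Z k) m]
      noncomm_ring
  have := (tendsto_const_nhds (x := φ (Y ^ m))).sub (key2 m 0)
  simpa using this

end IsFaithfulTracialState

end TracialState

/-! ### Double Wigner integrals as limits of quadratic forms -/

section SpectralApproximation

variable {A : Type*} [CStarAlgebra A] {φ : A →ₗ[ℂ] ℂ} {S : ℝ≥0 → A}

namespace StepKernel

/-- The step kernel with the same intervals and coefficients `(c_{ij} + ε c_{ji}) / 2`: the
symmetric part for `ε = 1`, the antisymmetric part for `ε = -1`. -/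
noncomputable def part (g : StepKernel) (ε : ℝ) : StepKernel where
  size := g.size
  time := g.time
  mono := g.mono
  coeff i j := (g.coeff i j + ε * g.coeff j i) / 2
  diag i := by simp [g.diag]

variable (g : StepKernel)

theorem toFun_part (ε : ℝ) (p : ℝ × ℝ) :
    (g.part ε).toFun p = (g.toFun p + ε * g.toFun p.swap) / 2 := by
  have e : g.toFun p.swap = ∑ i ∈ Finset.range g.size, ∑ j ∈ Finset.range g.size, g.coeff j i *
      ((Set.Ioc (g.time i : ℝ) (g.time (i + 1))).indicator 1 p.1 *
        (Set.Ioc (g.time j : ℝ) (g.time (j + 1))).indicator 1 p.2) := by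
    rw [toFun, Finset.sum_comm]
    refine Finset.sum_congr rfl fun i _ => Finset.sum_congr rfl fun j _ => ?_
    simp only [Prod.fst_swap, Prod.snd_swap]
    ring
  rw [e]
  simp only [toFun, part, Finset.mul_sum, ← Finset.sum_add_distrib, Finset.sum_div]
  refine Finset.sum_congr rfl fun i _ => Finset.sum_congr rfl fun j _ => ?_
  ring

theorem integral_eq_integral_part_add (S : ℝ≥0 → A) :
    g.integral S = (g.part 1).integral S + (g.part (-1)).integral S := by
  simp only [integral, part, ← Finset.sum_add_distrib, ← add_smul]
  refine Finset.sum_congr rfl fun i _ => Finset.sum_congr rfl fun j _ => ?_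
  congr 1
  push_cast
  ring

theorem star_integral_part (hS : ∀ t, IsSelfAdjoint (S t)) {ε : ℝ} (hε : ε * ε = 1) :
    star ((g.part ε).integral S) = ε • (g.part ε).integral S := by
  simp only [integral, part, star_sum, Finset.smul_sum]
  rw [Finset.sum_comm]
  refine Finset.sum_congr rfl fun i _ => Finset.sum_congr rfl fun j _ => ?_
  rw [star_smul, star_mul, star_sub, star_sub, (hS _).star_eq, (hS _).star_eq, (hS _).star_eq,
    (hS _).star_eq, ← Complex.coe_smul ε, smul_smul, ← Complex.ofReal_mul]
  congr 1
  rw [Complex.star_def, Complex.conj_ofReal]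
  congr 1
  linear_combination (-(g.coeff j i) / 2) * hε

theorem matrix_part_transpose {ε : ℝ} (hε : ε * ε = 1) (i j : Fin g.size) :
    (g.part ε).matrix j i = ε * (g.part ε).matrix i j := by
  change (g.coeff j i + ε * g.coeff i j) / 2 = ε * ((g.coeff i j + ε * g.coeff j i) / 2)
  linear_combination (-(g.coeff j i) / 2) * hε

theorem trace_sq_eq {ε : ℝ} (h : ∀ i j, g.matrix j i = ε * g.matrix i j) :
    ((g.matrix * Matrix.diagonal g.length) ^ 2).trace = ε * ‖g.toLp‖ ^ 2 := by
  rw [norm_toLp_sq, Finset.mul_sum, sq, Matrix.trace]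
  refine Finset.sum_congr rfl fun i _ => ?_
  rw [Matrix.diag_apply, Matrix.mul_apply, Finset.mul_sum]
  refine Finset.sum_congr rfl fun j _ => ?_
  rw [Matrix.mul_diagonal, Matrix.mul_diagonal, h i j]
  ring

theorem trace_eq_zero : (g.matrix * Matrix.diagonal g.length).trace = 0 := by
  rw [Matrix.trace]
  refine Finset.sum_eq_zero fun i _ => ?_
  rw [Matrix.diag_apply, Matrix.mul_diagonal]
  simp [matrix, g.diag]

end StepKernel

/-- The Wigner isometry, for antisymmetric kernels. -/
theorem IsFreeBrownianMotion.map_star_integral_mul_self (hφ : IsFaithfulTracialState φ)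
    (hS : IsFreeBrownianMotion φ S) (g : StepKernel) :
    (φ (star ((g.part (-1)).integral S) * (g.part (-1)).integral S)).re =
      ‖(g.part (-1)).toLp‖ ^ 2 := by
  have hκ : ∀ r, r ≠ 0 → _ := fun r hr => hS.freeCumulant_add_integral hφ le_rfl
    (hasLaw_zero hφ.map_one) (freelyIndependentOf_zero hφ.map_one S) (g.part (-1)) (r := r) hr
  simp only [zero_add, ite_self] at hκ
  have h1 := hκ 1 one_ne_zero
  rw [pow_one, StepKernel.trace_eq_zero, Complex.ofReal_zero] at h1
  have h2 := hκ 2 two_ne_zero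
  rw [← map_sq_eq_freeCumulant_two hφ.map_one h1,
    StepKernel.trace_sq_eq (ε := -1) _ (g.matrix_part_transpose (by norm_num))] at h2
  rw [g.star_integral_part hS.selfAdjoint (by norm_num), neg_one_smul, neg_mul, map_neg, ← sq, h2,
    ← Complex.ofReal_neg, Complex.ofReal_re, neg_one_mul, neg_neg]

theorem tendsto_norm_part {f : L2Plane} (hf : IsSymm f) {g : ℕ → StepKernel}
    (hg : Tendsto (fun k => eLpNorm (fun p => f p - (g k).toFun p) 2 (halfLine.prod halfLine))
      atTop (𝓝 0)) :
    Tendsto (fun k => ‖f - ((g k).part 1).toLp‖) atTop (𝓝 0) ∧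
      Tendsto (fun k => ‖((g k).part (-1)).toLp‖) atTop (𝓝 0) := by
  have hmp : MeasurePreserving (Prod.swap : ℝ × ℝ → ℝ × ℝ) (halfLine.prod halfLine)
      (halfLine.prod halfLine) := Measure.measurePreserving_swap
  let h : ℕ → ℝ × ℝ → ℝ := fun k p => f p - (g k).toFun p
  have hd : ∀ k, AEStronglyMeasurable (h k) (halfLine.prod halfLine) :=
    fun k => (Lp.memLp f).1.sub (g k).memLp_toFun.1
  -- both norms are at most the norm of `h = f - g`, as the functions are `(h ± h ∘ swap) / 2`
  have main : ∀ (u : ℕ → L2Plane) (c : ℝ), |c| = 1 / 2 →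
      (∀ k, u k =ᵐ[halfLine.prod halfLine] (1 / 2 : ℝ) • h k + c • (h k ∘ Prod.swap)) →
      Tendsto (fun k => ‖u k‖) atTop (𝓝 0) := by
    intro u c hc hu
    have hle : ∀ k, eLpNorm (u k) 2 (halfLine.prod halfLine) ≤
        eLpNorm (h k) 2 (halfLine.prod halfLine) := by
      intro k
      have hc1 : ‖(1 / 2 : ℝ)‖ₑ + ‖c‖ₑ = 1 := by
        rw [Real.enorm_eq_ofReal_abs, Real.enorm_eq_ofReal_abs, hc,
          ← ENNReal.ofReal_add (by positivity) (by positivity)]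
        norm_num
      rw [eLpNorm_congr_ae (hu k)]
      refine (eLpNorm_add_le ((hd k).const_smul _)
        (((hd k).comp_measurePreserving hmp).const_smul c) (by norm_num)).trans ?_
      rw [eLpNorm_const_smul, eLpNorm_const_smul, eLpNorm_comp_measurePreserving (hd k) hmp,
        ← add_mul, hc1, one_mul]
    have h0 : Tendsto (fun k => eLpNorm (u k) 2 (halfLine.prod halfLine)) atTop (𝓝 0) :=
      tendsto_of_tendsto_of_tendsto_of_le_of_le tendsto_const_nhds hg (fun k => zero_le) hle
    exact (ENNReal.tendsto_toReal ENNReal.zero_ne_top).comp h0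
  have hpart : ∀ k ε, ((g k).part ε).toLp =ᵐ[halfLine.prod halfLine]
      fun p => ((g k).toFun p + ε * (g k).toFun p.swap) / 2 := fun k ε => by
    filter_upwards [((g k).part ε).memLp_toFun.coeFn_toLp] with p hp
    rw [StepKernel.toLp, hp, StepKernel.toFun_part]
  constructor
  · refine main _ (1 / 2) (by norm_num) fun k => ?_
    filter_upwards [hpart k 1, Lp.coeFn_sub f ((g k).part 1).toLp, hf] with p h1 h2 h3
    rw [h2, Pi.sub_apply, h1]
    simp only [h, Pi.add_apply, Pi.smul_apply, Function.comp_apply, h3, smul_eq_mul]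
    ring
  · have := main (fun k => -((g k).part (-1)).toLp) (-1 / 2) (by norm_num) fun k => by
      filter_upwards [hpart k (-1), Lp.coeFn_neg ((g k).part (-1)).toLp, hf] with p h1 h2 h3
      rw [h2, Pi.neg_apply, h1]
      simp only [h, Pi.add_apply, Pi.smul_apply, Function.comp_apply, h3, smul_eq_mul]
      ring
    simpa using this

/-- The kernel and the double Wigner integral of a symmetric `f` are simultaneously approximated by
symmetric step kernels; in particular the integral is self-adjoint. -/
theorem IsDoubleWignerIntegral.exists_symmetric (hφ : IsFaithfulTracialState φ)
    (hS : IsFreeBrownianMotion φ S) {f : L2Plane} (hf : IsSymm f) {F : A}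
    (hF : IsDoubleWignerIntegral φ S f F) :
    IsSelfAdjoint F ∧ ∃ g : ℕ → StepKernel, (∀ k, (g k).matrix.IsSymm) ∧
      (∀ k, IsSelfAdjoint ((g k).integral S)) ∧
      Tendsto (fun k => ‖f - (g k).toLp‖) atTop (𝓝 0) ∧
      Tendsto (fun k => (φ (star (F - (g k).integral S) * (F - (g k).integral S))).re)
        atTop (𝓝 0) := by
  obtain ⟨g, hg, hgF⟩ := hF
  obtain ⟨h1, h2⟩ := tendsto_norm_part hf hg
  have hsymm : ∀ k, ((g k).part 1).matrix.IsSymm := fun k =>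
    Matrix.IsSymm.ext fun i j => by
      rw [(g k).matrix_part_transpose (by norm_num) i j, one_mul]
  have hsa : ∀ k, IsSelfAdjoint (((g k).part 1).integral S) := fun k => by
    rw [IsSelfAdjoint, (g k).star_integral_part hS.selfAdjoint (by norm_num), one_smul]
  have hgF' : Tendsto (fun k => (φ (star (F - (g k).integral S) * (F - (g k).integral S))).re)
      atTop (𝓝 0) := by
    exact (Complex.continuous_re.tendsto 0).comp hgF
  have hlim : Tendsto (fun k => (φ (star (F - ((g k).part 1).integral S) *
      (F - ((g k).part 1).integral S))).re) atTop (𝓝 0) := by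
    have hbound := (hgF'.const_mul 2).add ((h2.pow 2).const_mul 2)
    rw [zero_pow two_ne_zero, mul_zero, add_zero] at hbound
    refine squeeze_zero (fun k => (hφ.nonneg _).1) (fun k => ?_) hbound
    have e : F - ((g k).part 1).integral S =
        (F - (g k).integral S) + ((g k).part (-1)).integral S := by
      rw [(g k).integral_eq_integral_part_add S]
      abel
    rw [e, ← hS.map_star_integral_mul_self hφ]
    exact hφ.map_star_mul_self_add_le _ _
  refine ⟨?_, _, hsymm, hsa, h1, hlim⟩
  have hle : ∀ k, (φ (star (star F - F) * (star F - F))).re ≤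
      4 * (φ (star (F - ((g k).part 1).integral S) * (F - ((g k).part 1).integral S))).re := by
    intro k
    set z := F - ((g k).part 1).integral S with hz
    have e : star F - F = star z + -z := by
      rw [hz, star_sub, (hsa k).star_eq]
      abel
    have h := hφ.map_star_mul_self_add_le (star z) (-z)
    rw [← e, star_star, hφ.trace z, star_neg, neg_mul_neg] at h
    linarith
  have h0 : (φ (star (star F - F) * (star F - F))).re = 0 :=
    le_antisymm (ge_of_tendsto' (by rw [← mul_zero (4 : ℝ)]; exact hlim.const_mul 4) hle)
      (hφ.nonneg _).1
  exact sub_eq_zero.1 (hφ.faithful _ (by rw [hφ.map_star_mul_self, h0, Complex.ofReal_zero]))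

theorem tendsto_norm_of_tendsto_norm_sub {f : L2Plane} {u : ℕ → L2Plane}
    (h : Tendsto (fun k => ‖f - u k‖) atTop (𝓝 0)) :
    Tendsto (fun k => ‖u k‖) atTop (𝓝 ‖f‖) := by
  have : Tendsto (fun k => f - u k) atTop (𝓝 0) := tendsto_zero_iff_norm_tendsto_zero.2 h
  have h2 := (tendsto_const_nhds (x := f)).sub this
  simpa using h2.norm

theorem abs_sum_pow_le {n : ℕ} (l : Fin n → ℝ) {K : ℝ} (hl : ∀ i, |l i| ≤ K) (r : ℕ) :
    |∑ i, l i ^ (r + 2)| ≤ K ^ r * ∑ i, l i ^ 2 := by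
  rw [Finset.mul_sum]
  refine (Finset.abs_sum_le_sum_abs _ _).trans (Finset.sum_le_sum fun i _ => ?_)
  rw [pow_add, abs_mul, abs_pow, abs_pow, sq_abs]
  exact mul_le_mul_of_nonneg_right (pow_le_pow_left₀ (abs_nonneg _) (hl i) r) (sq_nonneg _)

open Polynomial in
/-- On almost-eigenvectors `u` for `l`, the operator `p(T)` is almost `p(l)`. -/
theorem exists_norm_aeval_sub_le {H : Type*} [NormedAddCommGroup H] [InnerProductSpace ℝ H]
    (T : Module.End ℝ H) {K : ℝ} (hK : 0 ≤ K) (hT : ∀ u, ‖T u‖ ≤ K * ‖u‖) (p : ℝ[X]) :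
    ∃ c : ℝ, 0 ≤ c ∧ ∀ (l : ℝ) (u : H), |l| ≤ K →
      ‖aeval T p u - p.eval l • u‖ ≤ c * ‖T u - l • u‖ := by
  induction p using Polynomial.induction_on' with
  | add p q hp hq =>
    obtain ⟨c, hc, h⟩ := hp
    obtain ⟨d, hd, h'⟩ := hq
    refine ⟨c + d, add_nonneg hc hd, fun l u hl => ?_⟩
    rw [map_add, LinearMap.add_apply, eval_add, add_smul, add_sub_add_comm, add_mul]
    exact (norm_add_le _ _).trans (add_le_add (h l u hl) (h' l u hl))
  | monomial n b =>
    have hpow : ∃ c : ℝ, 0 ≤ c ∧ ∀ (l : ℝ) (u : H), |l| ≤ K →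
        ‖(T ^ n) u - l ^ n • u‖ ≤ c * ‖T u - l • u‖ := by
      induction n with
      | zero => exact ⟨0, le_rfl, fun l u _ => by simp⟩
      | succ n ih =>
        obtain ⟨c, hc, h⟩ := ih
        refine ⟨K * c + K ^ n, by positivity, fun l u hl => ?_⟩
        have e : (T ^ (n + 1)) u - l ^ (n + 1) • u =
            T ((T ^ n) u - l ^ n • u) + l ^ n • (T u - l • u) := by
          rw [pow_succ', Module.End.mul_apply, map_sub, map_smul, smul_sub, smul_smul, pow_succ]
          abel
        rw [e, add_mul]
        refine (norm_add_le _ _).trans (add_le_add ?_ ?_)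
        · rw [mul_assoc]
          exact (hT _).trans (mul_le_mul_of_nonneg_left (h l u hl) hK)
        · rw [norm_smul, norm_pow, Real.norm_eq_abs]
          exact mul_le_mul_of_nonneg_right (pow_le_pow_left₀ (abs_nonneg _) hl n) (norm_nonneg _)
    obtain ⟨c, hc, h⟩ := hpow
    refine ⟨|b| * c, by positivity, fun l u hl => ?_⟩
    rw [aeval_monomial, eval_monomial, ← Algebra.smul_def, LinearMap.smul_apply, mul_smul,
      ← smul_sub, norm_smul, Real.norm_eq_abs, mul_assoc]
    exact mul_le_mul_of_nonneg_left (h l u hl) (abs_nonneg _)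

open Polynomial in
/-- Finite spectra `l k`, those of step kernels approximating `f`, whose power sums converge to the
free cumulants of a double Wigner integral of `f`. They concentrate on the zeros of every polynomial
that annihilates `T_f`. -/
theorem IsDoubleWignerIntegral.exists_spectra (hφ : IsFaithfulTracialState φ)
    (hS : IsFreeBrownianMotion φ S) {f : L2Plane} (hf : IsSymm f) {F : A}
    (hF : IsDoubleWignerIntegral φ S f F) :
    ∃ (n : ℕ → ℕ) (l : ∀ k, Fin (n k) → ℝ),
      (∀ (a : A) (v₀ : ℝ), 0 ≤ v₀ → HasLaw φ a (semicircularLaw v₀) → FreelyIndependentOf φ a S →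
        freeCumulant φ (a + F) 1 = 0 ∧ ∀ r, 2 ≤ r →
          Tendsto (fun k => (((if r = 2 then v₀ else 0) + ∑ i, l k i ^ r : ℝ) : ℂ)) atTop
            (𝓝 (freeCumulant φ (a + F) r))) ∧
      Tendsto (fun k => ∑ i, l k i ^ 2) atTop (𝓝 (‖f‖ ^ 2)) ∧
      ∀ p : ℝ[X], aeval (kernelOperator f) p = 0 →
        Tendsto (fun k => ∑ i, p.eval (l k i) ^ 2) atTop (𝓝 0) := by
  obtain ⟨hFsa, g, hsymm, hgsa, hgf, hgF⟩ := hF.exists_symmetric hφ hS hf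
  -- `l k` and `e k` are the nonzero eigenvalues and the eigenvectors of the `k`-th step kernel
  choose n l e he hle htr using fun k => (g k).exists_eigenvectors (hsymm k)
  have hnorm := tendsto_norm_of_tendsto_norm_sub hgf
  obtain ⟨K, hK⟩ := hnorm.bddAbove_range
  have hgK : ∀ k, ‖(g k).toLp‖ ≤ K := fun k => hK ⟨k, rfl⟩
  have hK0 : 0 ≤ K := (norm_nonneg _).trans (hgK 0)
  have hsq : ∀ k, ∑ i, l k i ^ 2 = ‖(g k).toLp‖ ^ 2 := fun k => by
    rw [← htr k 2 two_ne_zero, StepKernel.trace_sq_eq (ε := 1) _ fun i j => by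
      rw [one_mul, (hsymm k).apply], one_mul]
  have hlK : ∀ k i, |l k i| ≤ K := fun k i => by
    refine abs_le_of_sq_le_sq (le_trans ?_ (pow_le_pow_left₀ (norm_nonneg _) (hgK k) 2)) hK0
    rw [← hsq k]
    exact Finset.single_le_sum (f := fun i => l k i ^ 2) (fun i _ => sq_nonneg _)
      (Finset.mem_univ i)
  refine ⟨n, l, fun a v₀ hv₀ ha haS => ?_, ?_, fun p hp => ?_⟩
  · have hκ : ∀ k r, r ≠ 0 → freeCumulant φ (a + (g k).integral S) r =
        (((if r = 2 then v₀ else 0) + ∑ i, l k i ^ r : ℝ) : ℂ) := fun k r hr => by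
      rw [hS.freeCumulant_add_integral hφ hv₀ ha haS (g k) hr, htr k r hr]
    have hκ1 : ∀ k, freeCumulant φ (a + (g k).integral S) 1 = 0 := fun k => by
      rw [hS.freeCumulant_add_integral hφ hv₀ ha haS (g k) one_ne_zero, pow_one,
        StepKernel.trace_eq_zero]
      simp
    have hbddκ : ∀ r, (fun k => freeCumulant φ (a + (g k).integral S) r) ∈ boundedSequences := by
      intro r
      match r with
      | 0 => exact ⟨1, fun k => by simp [freeCumulant_zero hφ.map_one]⟩
      | 1 => exact ⟨0, fun k => by simp [hκ1]⟩
      | r + 2 =>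
        refine ⟨v₀ + K ^ r * K ^ 2, fun k => ?_⟩
        simp only [hκ k (r + 2) (by omega)]
        rw [Complex.norm_real, Real.norm_eq_abs]
        refine (abs_add_le _ _).trans (add_le_add ?_ ?_)
        · split_ifs
          · rw [abs_of_nonneg hv₀]
          · simpa using hv₀
        · refine (abs_sum_pow_le (l k) (hlK k) r).trans
            (mul_le_mul_of_nonneg_left ?_ (pow_nonneg hK0 r))
          rw [hsq]
          exact pow_le_pow_left₀ (norm_nonneg _) (hgK k) 2
    have hmom := hφ.tendsto_moment (Y := a + F) (Z := fun k => a + (g k).integral S)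
      (ha.1.add hFsa) (fun k => ha.1.add (hgsa k))
      (moment_mem_of_freeCumulant_mem hφ.map_one boundedSequences _ hbddκ)
      (by simpa only [add_sub_add_left_eq_sub] using hgF)
    have hlim := tendsto_freeCumulant hmom
    refine ⟨tendsto_nhds_unique (hlim 1) (by simp [hκ1]), fun r hr => ?_⟩
    exact (hlim r).congr fun k => hκ k r (by omega)
  · simpa only [hsq] using hnorm.pow 2
  · obtain ⟨c, hc, h⟩ := exists_norm_aeval_sub_le (kernelOperator f) (K := max K ‖f‖)
      (le_max_of_le_left hK0) (fun u => (norm_kernelOperator_le f u).trans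
        (mul_le_mul_of_nonneg_right (le_max_right _ _) (norm_nonneg _))) p
    refine squeeze_zero (fun k => Finset.sum_nonneg fun i _ => sq_nonneg _) (fun k => ?_)
      (by simpa using (hgf.pow 2).const_mul (c ^ 2))
    -- `‖p(l) e‖ = ‖(p(T_f) - p(l)) e‖ ≤ c ‖(T_f - l) e‖ = c ‖T_{f - g} e‖`, then Bessel
    refine le_trans (Finset.sum_le_sum fun i _ => ?_)
      ((Finset.mul_sum _ _ _).symm.le.trans (mul_le_mul_of_nonneg_left
        (sum_norm_kernelOperator_sq_le (f - (g k).toLp) (he k)) (sq_nonneg c)))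
    have h1 := h (l k i) (e k i) ((hlK k i).trans (le_max_left _ _))
    rw [hp, LinearMap.zero_apply, zero_sub, norm_neg, norm_smul, (he k).1 i, mul_one,
      Real.norm_eq_abs, ← hle k i, ← kernelOperator_sub] at h1
    rw [← sq_abs, ← mul_pow]
    exact pow_le_pow_left₀ (abs_nonneg _) h1 2

end SpectralApproximation

/-! ### Convergence of power sums -/

section PowerSums

open Polynomial

/-- The linear functional on polynomials with `Xᵏ ↦ c k`. -/
noncomputable def polyMean (c : ℕ → ℝ) : ℝ[X] →ₗ[ℝ] ℝ :=
  Polynomial.lsum fun k => c k • LinearMap.id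

theorem polyMean_monomial (c : ℕ → ℝ) (k : ℕ) (b : ℝ) : polyMean c (monomial k b) = b * c k := by
  rw [polyMean, lsum_apply, sum_monomial_index _ _ (by simp)]
  simp [mul_comm]

theorem polyMean_X_pow (c : ℕ → ℝ) (k : ℕ) : polyMean c (X ^ k) = c k := by
  rw [X_pow_eq_monomial, polyMean_monomial, one_mul]

theorem polyMean_eq_sum_range (c : ℕ → ℝ) (p : ℝ[X]) :
    polyMean c p = ∑ k ∈ Finset.range (p.natDegree + 1), p.coeff k * c k := by
  rw [polyMean, lsum_apply, sum_over_range _ (by simp)]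
  simp [mul_comm]

/-- `c k` is the limit of the power sums `∑ᵢ lᵢᵏ⁺²` of the finite spectra `l m`. -/
def IsPowerSumLimit {n : ℕ → ℕ} (l : ∀ m, Fin (n m) → ℝ) (c : ℕ → ℝ) : Prop :=
  ∀ k, Tendsto (fun m => ∑ i, l m i ^ (k + 2)) atTop (𝓝 (c k))

variable {n : ℕ → ℕ} {l : ∀ m, Fin (n m) → ℝ} {c : ℕ → ℝ}

namespace IsPowerSumLimit

theorem tendsto_polyMean (h : IsPowerSumLimit l c) (p : ℝ[X]) :
    Tendsto (fun m => ∑ i, l m i ^ 2 * p.eval (l m i)) atTop (𝓝 (polyMean c p)) := by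
  induction p using Polynomial.induction_on' with
  | add p q hp hq =>
    rw [map_add]
    refine (hp.add hq).congr fun m => ?_
    simp only [eval_add, mul_add, Finset.sum_add_distrib]
  | monomial k b =>
    rw [polyMean_monomial]
    refine ((h k).const_mul b).congr fun m => ?_
    rw [Finset.mul_sum]
    refine Finset.sum_congr rfl fun i _ => ?_
    rw [eval_monomial]
    ring

theorem polyMean_mul_sq_le (h : IsPowerSumLimit l c) (p q : ℝ[X]) :
    polyMean c (p * q) ^ 2 ≤ polyMean c (p ^ 2) * polyMean c (q ^ 2) := by
  refine le_of_tendsto_of_tendsto' ((h.tendsto_polyMean _).pow 2)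
    ((h.tendsto_polyMean _).mul (h.tendsto_polyMean _)) fun m => ?_
  have := Finset.sum_mul_sq_le_sq_mul_sq Finset.univ (fun i => l m i * p.eval (l m i))
    (fun i => l m i * q.eval (l m i))
  simp only [mul_pow] at this
  simp only [eval_mul, eval_pow]
  convert this using 3
  ring

theorem polyMean_sq_nonneg (h : IsPowerSumLimit l c) (p : ℝ[X]) : 0 ≤ polyMean c (p ^ 2) := by
  refine ge_of_tendsto' (h.tendsto_polyMean _) fun m => Finset.sum_nonneg fun i _ => ?_
  rw [eval_pow]
  positivity

/-- Each `lᵢ²` is at most `∑ lᵢ²`. -/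
theorem le_pow (h : IsPowerSumLimit l c) (k : ℕ) : c (2 * k) ≤ c 0 ^ (k + 1) := by
  refine le_of_tendsto_of_tendsto' (h (2 * k)) ((h 0).pow (k + 1)) fun m => ?_
  rw [pow_succ, Finset.mul_sum]
  refine Finset.sum_le_sum fun i _ => ?_
  rw [pow_add, pow_mul, zero_add]
  refine mul_le_mul_of_nonneg_right (pow_le_pow_left₀ (sq_nonneg _) ?_ k) (sq_nonneg _)
  exact Finset.single_le_sum (f := fun i => l m i ^ 2) (fun i _ => sq_nonneg _) (Finset.mem_univ i)

theorem sq_le (h : IsPowerSumLimit l c) (k : ℕ) : c k ^ 2 ≤ c 0 * c 0 ^ (k + 1) := by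
  have h1 := h.polyMean_mul_sq_le 1 (X ^ k)
  have h2 := h.polyMean_sq_nonneg 1
  have e : (1 : ℝ[X]) = X ^ 0 := (pow_zero X).symm
  rw [one_mul, one_pow, ← pow_mul, polyMean_X_pow, polyMean_X_pow, e, polyMean_X_pow] at h1
  rw [one_pow, e, polyMean_X_pow] at h2
  rw [mul_comm k 2] at h1
  exact h1.trans (mul_le_mul_of_nonneg_left (h.le_pow k) h2)

end IsPowerSumLimit

/-- For spectra with bounded sums of squares, all polynomial sums are bounded. -/
theorem exists_abs_polyMean_le {c : ℕ → ℕ → ℝ} {B : ℝ}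
    (hc : ∀ n k, c n k ^ 2 ≤ c n 0 * c n 0 ^ (k + 1)) (hB : ∀ n, |c n 0| ≤ B) (p : ℝ[X]) :
    ∃ D, ∀ n, |polyMean (c n) p| ≤ D := by
  induction p using Polynomial.induction_on' with
  | add p q hp hq =>
    obtain ⟨D, hD⟩ := hp
    obtain ⟨D', hD'⟩ := hq
    refine ⟨D + D', fun n => ?_⟩
    rw [map_add]
    exact (abs_add_le _ _).trans (add_le_add (hD n) (hD' n))
  | monomial k b =>
    refine ⟨|b| * √(B * B ^ (k + 1)), fun n => ?_⟩
    rw [polyMean_monomial, abs_mul]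
    refine mul_le_mul_of_nonneg_left (Real.abs_le_sqrt ((hc n k).trans ?_)) (abs_nonneg _)
    rw [← pow_succ', ← pow_succ']
    exact (le_abs_self _).trans ((abs_pow _ _).le.trans (pow_le_pow_left₀ (abs_nonneg _) (hB n) _))

/-- If the spectra concentrate on the zeros of `P`, then the polynomial sums vanish asymptotically
on the ideal generated by `P`. -/
theorem tendsto_polyMean_mul {c : ℕ → ℕ → ℝ}
    (hc : ∀ n, ∃ (N : ℕ → ℕ) (l : ∀ m, Fin (N m) → ℝ), IsPowerSumLimit l (c n))
    {B : ℝ} (hB : ∀ n, |c n 0| ≤ B) {P : ℝ[X]}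
    (hP : Tendsto (fun n => polyMean (c n) (P ^ 2)) atTop (𝓝 0)) (q : ℝ[X]) :
    Tendsto (fun n => polyMean (c n) (P * q)) atTop (𝓝 0) := by
  choose N l hl using hc
  obtain ⟨D, hD⟩ := exists_abs_polyMean_le (fun n => (hl n).sq_le) hB (q ^ 2)
  have h1 : Tendsto (fun n => polyMean (c n) (P * q) ^ 2) atTop (𝓝 0) := by
    refine squeeze_zero (fun n => sq_nonneg _) (fun n => ?_) (by simpa using hP.mul_const D)
    exact ((hl n).polyMean_mul_sq_le P q).trans
      (mul_le_mul_of_nonneg_left ((le_abs_self _).trans (hD n)) ((hl n).polyMean_sq_nonneg P))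
  have h2 := h1.sqrt
  simp only [Real.sqrt_sq_eq_abs, Real.sqrt_zero] at h2
  exact tendsto_zero_iff_abs_tendsto_zero _ |>.2 h2

/-- When `X` is invertible modulo the monic polynomial `P`, the powers `Xʰ, …, Xʰ⁺ᵃ⁻¹` with
`a = deg P` span the quotient by `P`. -/
theorem exists_eq_X_pow_mul_add {P : ℝ[X]} (hP : P.Monic) (hX : IsCoprime X P) (h : ℕ)
    (p : ℝ[X]) : ∃ r s : ℝ[X], r.degree < P.degree ∧ p = X ^ h * r + P * s := by
  obtain ⟨u, v, huv⟩ := hX.pow_left (m := h)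
  refine ⟨(p * u) %ₘ P, X ^ h * ((p * u) /ₘ P) + p * v, degree_modByMonic_lt _ hP, ?_⟩
  have e := modByMonic_add_div (p * u) P
  linear_combination (-p) * huv - X ^ h * e

/-- Convergence of the first power sum, of `a = deg P` consecutive ones, and concentration on the
zeros of `Xᵉ P` determine the limit of all power sums. -/
theorem tendsto_of_tendsto_consecutive {c : ℕ → ℕ → ℝ} {L : ℕ → ℝ}
    (hc : ∀ n, ∃ (N : ℕ → ℕ) (l : ∀ m, Fin (N m) → ℝ), IsPowerSumLimit l (c n))
    {P : ℝ[X]} (hP : P.Monic) (hX : IsCoprime X P) {e h : ℕ} (he : e ≤ 1) (heh : e ≤ h)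
    (h0 : Tendsto (fun n => c n 0) atTop (𝓝 (L 0)))
    (hsq : Tendsto (fun n => polyMean (c n) ((X ^ e * P) ^ 2)) atTop (𝓝 0))
    (hL : ∀ q, polyMean L (X ^ e * P * q) = 0)
    (hcons : ∀ j < P.natDegree, Tendsto (fun n => c n (h + j)) atTop (𝓝 (L (h + j)))) (k : ℕ) :
    Tendsto (fun n => c n k) atTop (𝓝 (L k)) := by
  obtain ⟨B, hB⟩ := h0.abs.bddAbove_range
  have hideal : ∀ q, Tendsto (fun n => polyMean (c n) (X ^ e * P * q)) atTop
      (𝓝 (polyMean L (X ^ e * P * q))) := fun q => by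
    rw [hL]
    exact tendsto_polyMean_mul hc (fun n => hB ⟨n, rfl⟩) hsq q
  have hshift : ∀ r : ℝ[X], r.degree < P.degree →
      Tendsto (fun n => polyMean (c n) (X ^ h * r)) atTop (𝓝 (polyMean L (X ^ h * r))) := by
    intro r hr
    have e1 : ∀ c, polyMean c (X ^ h * r) =
        ∑ j ∈ Finset.range P.natDegree, r.coeff j * c (h + j) := by
      intro c
      have hr' : r = ∑ j ∈ Finset.range P.natDegree, monomial j (r.coeff j) := by
        by_cases hr0 : r = 0
        · simp [hr0]
        · refine r.as_sum_range' _ ((natDegree_lt_iff_degree_lt hr0).2 ?_)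
          rwa [← degree_eq_natDegree hP.ne_zero]
      conv_lhs => rw [hr', Finset.mul_sum, map_sum]
      refine Finset.sum_congr rfl fun j _ => ?_
      rw [X_pow_mul_monomial, polyMean_monomial, add_comm j h]
    simp only [e1]
    exact tendsto_finsetSum _ fun j hj => (hcons j (Finset.mem_range.1 hj)).const_mul _
  have hall : ∀ p : ℝ[X], Tendsto (fun n => polyMean (c n) p) atTop (𝓝 (polyMean L p)) := by
    intro p
    interval_cases e
    -- `p = Xʰ r + P s`, and for `e = 1` the same for the quotient of `p - p(0)` by `X`
    · obtain ⟨r, s, hr, hp⟩ := exists_eq_X_pow_mul_add hP hX h p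
      have := (hshift r hr).add (hideal s)
      simp only [← map_add, pow_zero, one_mul, ← hp] at this
      exact this
    · obtain ⟨h, rfl⟩ := Nat.exists_eq_add_of_le' heh
      obtain ⟨r, s, hr, hp⟩ := exists_eq_X_pow_mul_add hP hX h p.divX
      have h1 : ∀ c, polyMean c (C (p.coeff 0)) = p.coeff 0 * c 0 := fun c => by
        rw [← monomial_zero_left, polyMean_monomial]
      have h2 := ((h0.const_mul (p.coeff 0)).add (hshift r hr)).add (hideal s)
      have h3 : C (p.coeff 0) + X ^ (h + 1) * r + X ^ 1 * P * s = p := by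
        conv_rhs => rw [← divX_mul_X_add p, hp]
        ring
      simp only [← h1, ← map_add, h3] at h2
      exact h2
  simpa only [polyMean_X_pow] using hall (X ^ k)

theorem taylorCoeff_eq_coeff (Q : ℝ[X]) (r : ℕ) : taylorCoeff Q r = Q.coeff r := by
  rw [taylorCoeff, ← coeff_zero_eq_eval_zero, coeff_iterate_derivative, zero_add,
    Nat.descFactorial_self, nsmul_eq_mul, mul_div_cancel_left₀]
  exact_mod_cast r.factorial_ne_zero

theorem sum_taylorCoeff_eq {R : ℝ[X]} (hR : R ≠ 0) {κ : ℕ → ℂ} {c : ℕ → ℝ}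
    (hκ : ∀ r, 3 ≤ r → κ r = c (r - 2)) :
    ∑ r ∈ Finset.Icc 3 (X ^ 2 * R).natDegree, (taylorCoeff (X ^ 2 * R) r : ℂ) * κ r =
      ((polyMean c R - R.coeff 0 * c 0 : ℝ) : ℂ) := by
  have hd : (X ^ 2 * R).natDegree = R.natDegree + 2 := by
    rw [natDegree_mul (by simp) hR, natDegree_X_pow, add_comm]
  have hset : Finset.Icc 3 (R.natDegree + 2) = Finset.Ico (1 + 2) (R.natDegree + 1 + 2) := by
    ext r
    simp only [Finset.mem_Icc, Finset.mem_Ico]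
    omega
  rw [polyMean_eq_sum_range, Finset.range_eq_Ico, Finset.sum_eq_sum_Ico_succ_bot (by omega),
    add_sub_cancel_left, hd, hset, ← Finset.sum_Ico_add']
  push_cast
  refine Finset.sum_congr rfl fun k hk => ?_
  rw [taylorCoeff_eq_coeff, coeff_X_pow_mul, hκ (k + 2) (by have := Finset.mem_Ico.1 hk; omega),
    Nat.add_sub_cancel]

end PowerSums

/-! ### Cumulants of the limit and of the sequence -/

section Limit

open Polynomial

variable {A : Type*} [CStarAlgebra A] {φ : A →ₗ[ℂ] ℂ} {S : ℝ≥0 → A}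

theorem eq_ofReal_of_tendsto {u : ℕ → ℝ} {z : ℂ}
    (h : Tendsto (fun k => (u k : ℂ)) atTop (𝓝 z)) :
    z = (z.re : ℂ) ∧ Tendsto u atTop (𝓝 z.re) := by
  have h1 : Tendsto u atTop (𝓝 z.re) := by
    simpa [Function.comp_def] using (Complex.continuous_re.tendsto z).comp h
  refine ⟨tendsto_nhds_unique h ?_, h1⟩
  exact (Complex.continuous_ofReal.tendsto _).comp h1

theorem InSecondWignerChaos.exists_isPowerSumLimit (hφ : IsFaithfulTracialState φ)
    (hS : IsFreeBrownianMotion φ S) {F : A} (hF : InSecondWignerChaos φ S F) :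
    freeCumulant φ F 1 = 0 ∧ ∃ c : ℕ → ℝ, (∀ r, 2 ≤ r → freeCumulant φ F r = c (r - 2)) ∧
      ∃ (N : ℕ → ℕ) (l : ∀ m, Fin (N m) → ℝ), IsPowerSumLimit l c := by
  obtain ⟨f, hf, hF⟩ := hF
  obtain ⟨n, l, hκ, -, -⟩ := hF.exists_spectra hφ hS hf
  obtain ⟨h1, h2⟩ := hκ 0 0 le_rfl (hasLaw_zero hφ.map_one) (freelyIndependentOf_zero hφ.map_one S)
  simp only [zero_add, ite_self] at h1 h2
  refine ⟨h1, fun k => (freeCumulant φ F (k + 2)).re, fun r hr => ?_, n, l, fun k => ?_⟩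
  · simp only [Nat.sub_add_cancel hr]
    exact (eq_ofReal_of_tendsto (h2 r hr)).1
  · exact (eq_ofReal_of_tendsto (h2 (k + 2) (by omega))).2

/-- The free cumulants of `a + I₂(f)`. The eigenvalues of `T_f` enter through the functional
`Xᵏ ↦ κ_{k+2}`, which vanishes on the ideal generated by `Xᵉ ∏ (X - l)`. -/
theorem IsDoubleWignerIntegral.exists_limit_cumulants (hφ : IsFaithfulTracialState φ)
    (hS : IsFreeBrownianMotion φ S) {f : L2Plane} (hf : IsSymm f) {μ₀ : ℝ} {a : A}
    (ha : HasLaw φ a (semicircularLaw (μ₀ ^ 2))) (haS : FreelyIndependentOf φ a S) {G : A}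
    (hG : IsDoubleWignerIntegral φ S f G) :
    freeCumulant φ (a + G) 1 = 0 ∧
      freeCumulant φ (a + G) 2 = ((μ₀ ^ 2 + ‖f‖ ^ 2 : ℝ) : ℂ) ∧
      (∀ r, 2 ≤ r → (r ≠ 2 ∨ μ₀ = 0) → freeCumulant φ (a + G) r = freeCumulant φ G r) ∧
      ∃ L : ℕ → ℝ, (∀ r, 2 ≤ r → freeCumulant φ (a + G) r = L (r - 2)) ∧
        ∀ (e : ℕ) (P : ℝ[X]), (μ₀ ≠ 0 → e ≠ 0) → aeval (kernelOperator f) (X * P) = 0 →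
          ∀ q, polyMean L (X ^ e * P * q) = 0 := by
  obtain ⟨n, l, hκ, hsq, hann⟩ := hG.exists_spectra hφ hS hf
  obtain ⟨h1, h2⟩ := hκ a _ (sq_nonneg μ₀) ha haS
  obtain ⟨-, h3⟩ := hκ 0 0 le_rfl (hasLaw_zero hφ.map_one) (freelyIndependentOf_zero hφ.map_one S)
  simp only [zero_add, ite_self] at h3
  have hre := fun r hr => eq_ofReal_of_tendsto (h2 r hr)
  have hre' := fun r hr => eq_ofReal_of_tendsto (h3 r hr)
  refine ⟨h1, ?_, fun r hr hr2 => tendsto_nhds_unique (h2 r hr) ?_,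
    fun k => (freeCumulant φ (a + G) (k + 2)).re, fun r hr => ?_, fun e P he hP q => ?_⟩
  · rw [(hre 2 le_rfl).1]
    congr 1
    refine tendsto_nhds_unique (hre 2 le_rfl).2 ?_
    simpa using hsq.const_add (μ₀ ^ 2)
  · have : (if r = 2 then μ₀ ^ 2 else 0) = 0 := by
      split_ifs with h
      · rw [hr2.resolve_left (not_not.2 h), zero_pow two_ne_zero]
      · rfl
    simpa only [this, zero_add] using h3 r hr
  · simp only [Nat.sub_add_cancel hr]
    exact (hre r hr).1
  · set c : ℕ → ℝ := fun k => (freeCumulant φ G (k + 2)).re with hc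
    have hlim : IsPowerSumLimit l c := fun k => (hre' (k + 2) (by omega)).2
    -- the semicircular part contributes `μ₀² p(0)`
    have hL : ∀ p : ℝ[X], polyMean (fun k => (freeCumulant φ (a + G) (k + 2)).re) p =
        μ₀ ^ 2 * p.coeff 0 + polyMean c p := by
      intro p
      induction p using Polynomial.induction_on' with
      | add p q hp hq => rw [map_add, map_add, hp, hq, coeff_add]; ring
      | monomial k b =>
        rw [polyMean_monomial, polyMean_monomial, coeff_monomial]
        have := tendsto_nhds_unique (hre (k + 2) (by omega)).2
          ((hlim k).const_add (if k + 2 = 2 then μ₀ ^ 2 else 0))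
        rw [this]
        by_cases hk : k = 0
        · simp only [hk, if_true, zero_add]
          ring
        · simp [hk]
    rw [hL]
    have hz : μ₀ ^ 2 * (X ^ e * P * q).coeff 0 = 0 := by
      by_cases hμ : μ₀ = 0
      · rw [hμ]
        ring
      · rw [mul_coeff_zero, mul_coeff_zero, coeff_X_pow, if_neg (Ne.symm (he hμ))]
        ring
    rw [hz, zero_add]
    refine tendsto_nhds_unique (hlim.tendsto_polyMean _) ?_
    -- Cauchy-Schwarz against the annihilating polynomial `X P`
    have hbound := ((hann _ hP).mul (hlim.tendsto_polyMean ((X ^ e * q) ^ 2))).sqrt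
    rw [zero_mul, Real.sqrt_zero] at hbound
    refine squeeze_zero_norm (fun m => ?_) hbound
    refine Real.abs_le_sqrt ?_
    have := Finset.sum_mul_sq_le_sq_mul_sq Finset.univ (fun i => (X * P).eval (l m i))
      (fun i => l m i * (X ^ e * q).eval (l m i))
    refine le_trans (le_of_eq (congrArg (· ^ 2) (Finset.sum_congr rfl fun i _ => ?_)))
      (this.trans (le_of_eq (congrArg (_ * ·) (Finset.sum_congr rfl fun i _ => ?_))))
    · simp only [eval_mul, eval_pow, eval_X]
      ring
    · rw [eval_pow, mul_pow]

end Limit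

end WignerChaos

theorem mainTheorem4 {A : Type*} [CStarAlgebra A] (φ : A →ₗ[ℂ] ℂ)
    (hφ : IsFaithfulTracialState φ) (S : ℝ≥0 → A) (hS : IsFreeBrownianMotion φ S)
    (f : L2Plane) (hf : IsSymm f) (hrank : HasFiniteRank f)
    (μ₀ : ℝ) (a : A) (ha : HasLaw φ a (semicircularLaw (μ₀ ^ 2)))
    (haS : FreelyIndependentOf φ a S) (hpos : 0 < |μ₀| + ‖f‖)
    (G : A) (hG : IsDoubleWignerIntegral φ S f G)
    (F : ℕ → A) (hF : ∀ n, InSecondWignerChaos φ S (F n)) :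
    freeCumulant φ (a + G) 2 = ((μ₀ ^ 2 + ‖f‖ ^ 2 : ℝ) : ℂ) ∧
    ∀ r₀ : ℕ, baseOrder μ₀ ≤ r₀ →
      (ConvergesInLaw φ F (a + G) ↔
        Tendsto (fun n => freeCumulant φ (F n) 2) atTop (𝓝 (freeCumulant φ (a + G) 2)) ∧
        Tendsto (fun n => ∑ r ∈ Finset.Icc 3 (polyQ μ₀ f).natDegree,
            (taylorCoeff (polyQ μ₀ f) r : ℂ) * freeCumulant φ (F n) r) atTop
          (𝓝 (∑ r ∈ Finset.Icc 3 (polyQ μ₀ f).natDegree,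
            (taylorCoeff (polyQ μ₀ f) r : ℂ) * freeCumulant φ G r)) ∧
        ∀ r ∈ Finset.Ico r₀ (r₀ + numEigenvalues f),
          Tendsto (fun n => freeCumulant φ (F n) r) atTop (𝓝 (freeCumulant φ G r))) := by
  classical
  obtain ⟨hκ1, hκ2, hκG, L, hκL, hLP⟩ := hG.exists_limit_cumulants hφ hS hf ha haS
  refine ⟨hκ2, fun r₀ hr₀ => ?_⟩
  have : FiniteDimensional ℝ (LinearMap.range (kernelOperator f)) := hrank
  obtain ⟨hE, hann⟩ := finite_eigenvalues_and_aeval_eq_zero (isSymmetric_kernelOperator hf)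
  choose hF1 c hκF hc using fun n => (hF n).exists_isPowerSumLimit hφ hS
  set e : ℕ := if μ₀ ≠ 0 then 1 else 0 with he
  set P : Polynomial ℝ := ∏ l ∈ hE.toFinset, (Polynomial.X - Polynomial.C l) with hP
  have hbase : baseOrder μ₀ = 2 * (1 + e) := rfl
  have he1 : e ≤ 1 := by rw [he]; split_ifs <;> omega
  have hμe : μ₀ ≠ 0 → e ≠ 0 := fun h => by rw [he, if_pos h]; exact one_ne_zero
  have hPm : P.Monic := Polynomial.monic_prod_of_monic _ _ fun l _ => Polynomial.monic_X_sub_C l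
  have hPX : IsCoprime Polynomial.X P := IsCoprime.prod_right fun l hl => by
    have h0 : (0 : ℝ) - l ≠ 0 := by simpa using (hE.mem_toFinset.1 hl).1
    simpa using Polynomial.isCoprime_X_sub_C_of_isUnit_sub h0.isUnit
  have hdeg : P.natDegree = numEigenvalues f := by
    rw [hP, Polynomial.natDegree_prod_of_monic _ _ fun l _ => Polynomial.monic_X_sub_C l]
    simp only [Polynomial.natDegree_X_sub_C, Finset.sum_const, smul_eq_mul, mul_one]
    exact (Set.ncard_eq_toFinset_card _ hE).symm
  have hQ : polyQ μ₀ f = Polynomial.X ^ 2 * (Polynomial.X ^ e * P) ^ 2 := by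
    have h1 : ∏ᶠ l ∈ nonzeroEigenvalues f, (Polynomial.X - Polynomial.C l) ^ 2 = P ^ 2 := by
      rw [hP, ← Finset.prod_pow]
      exact finprod_mem_eq_finite_toFinset_prod _ hE
    rw [polyQ, h1, hbase]
    ring
  have hR : (Polynomial.X ^ e * P) ^ 2 ≠ 0 :=
    (((Polynomial.monic_X_pow e).mul hPm).pow 2).ne_zero
  have hL0 : Polynomial.aeval (kernelOperator f) (Polynomial.X * P) = 0 := hann
  have hsumF : ∀ n, _ := fun n => sum_taylorCoeff_eq hR (κ := freeCumulant φ (F n)) (c := c n)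
    fun r hr => hκF n r (by omega)
  have hsumG := sum_taylorCoeff_eq hR (κ := freeCumulant φ G) (c := L) fun r hr => by
    rw [← hκG r (by omega) (Or.inl (by omega)), hκL r (by omega)]
  rw [← hQ] at hsumF hsumG
  -- convergence of complex cumulants, read off from their real values
  have hreal : ∀ r, 2 ≤ r → (Tendsto (fun n => freeCumulant φ (F n) r) atTop
      (𝓝 (freeCumulant φ (a + G) r)) ↔ Tendsto (fun n => c n (r - 2)) atTop (𝓝 (L (r - 2)))) := by
    intro r hr
    rw [hκL r hr, ← Filter.tendsto_ofReal_iff]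
    simp only [hκF _ r hr]
  have hGr : ∀ r, r₀ ≤ r → freeCumulant φ (a + G) r = freeCumulant φ G r := by
    intro r hr
    refine hκG r (by omega) ?_
    by_cases hμ : μ₀ = 0
    · exact Or.inr hμ
    · have := hμe hμ
      exact Or.inl (by omega)
  rw [convergesInLaw_iff_freeCumulant hφ.map_one]
  constructor
  · refine fun h => ⟨h 2, tendsto_finsetSum _ fun r hr => ?_, fun r hr => ?_⟩
    · have hr3 := (Finset.mem_Icc.1 hr).1
      rw [← hκG r (by omega) (Or.inl (by omega))]
      exact (h r).const_mul _
    · rw [← hGr r (Finset.mem_Ico.1 hr).1]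
      exact h r
  · rintro ⟨h2, hsum, hcons⟩
    have hc0 : Tendsto (fun n => c n 0) atTop (𝓝 (L 0)) := (hreal 2 le_rfl).1 h2
    -- the Taylor sums plus their missing `κ₂`-term are the values at `(Xᵉ P)²`; the limit is `0`
    simp only [hsumF, hsumG] at hsum
    have hsq := ((Filter.tendsto_ofReal_iff.1 hsum).add
      (hc0.const_mul (((Polynomial.X ^ e * P) ^ 2).coeff 0)))
    rw [sub_add_cancel, sq (Polynomial.X ^ e * P), hLP e P hμe hL0] at hsq
    simp only [sub_add_cancel, ← sq] at hsq
    have hall := tendsto_of_tendsto_consecutive hc hPm hPX he1 (h := r₀ - 2) (by omega) hc0 hsq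
      (hLP e P hμe hL0) fun j hj => by
        have h := hcons (r₀ + j) (Finset.mem_Ico.2 ⟨by omega, by omega⟩)
        rw [← hGr _ (by omega), hreal _ (by omega)] at h
        rwa [show r₀ + j - 2 = r₀ - 2 + j by omega] at h
    intro r
    match r with
    | 0 => simp [freeCumulant_zero hφ.map_one]
    | 1 => simp [hF1, hκ1]
    | r + 2 => exact (hreal (r + 2) (by omega)).2 (hall r)
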